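/- Let $V\subset\mathbb R^2$ be a bounded open neighbourhood of the origin. For $N\in\mathbb N$ let $C^N(\overline V)$ be the space of functions that are continuous on $\overline V$, of class $C^N$ in $V$, and whose partial derivatives of order at most $N$ extend continuously to $\overline V$, with the norm $\|F\|_{C^N(\overline V)}=\max_{\overline V}\sum_{|\alpha|\le N}|D^\alpha F|$. Let $f\in C^8(\overline V)$ be real-valued and of the form $$f(x_1,x_2)=x_1x_2^2+g(x_1,x_2)\quad\text{in } V,$$ where $g\in C^8(V)$ satisfies $D^\alpha g(0,0)=0$ for all multi-indices $\alpha$ with $|\alpha|\le 3$. (i) There are numbers $\varepsilon,C>0$ and an open neighbourhood $U\subset V$ of the origin such that for every $C^1$ function $a:\mathbb R^2\to\mathbb C$ with compact support contained in $U$, every real-valued $F\in C^8(\overline V)$ with $\|F\|_{C^8(\overline V)}<\varepsilon$ and every real $\lambda\neq0$, $$\left|\int_U e^{i\lambda(f(x)+F(x))}a(x)\,dx\right|\le\frac{C\,\|a\|_{C^1}}{|\lambda|^{1/2}},\qquad \|a\|_{C^1}=\max_{\overline U}\sum_{|\alpha|\le1}|D^\alpha a|.$$ (ii) If $g\equiv0$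 in $V$, this bound is sharp, already for $F=0$: for every open neighbourhood $U\subset V$ of the origin there are a $C^1$ function $a$ with compact support contained in $U$ and numbers $c,L>0$ such that $$\left|\int_U e^{i\lambda f(x)}a(x)\,dx\right|\ge\frac{c}{|\lambda|^{1/2}}\qquad\text{for all real }\lambda\text{ with }|\lambda|\ge L.$$ -/

import Mathlib

open MeasureTheory

noncomputable section

/-- The first partial derivative `∂h/∂x₁` of a function on the plane. -/
def pd1 {E : Type*} [NormedAddCommGroup E] [NormedSpace ℝ E] (h : ℝ × ℝ → E) : ℝ × ℝ → E :=
  fun p => fderiv ℝ h p (1, 0)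

/-- The second partial derivative `∂h/∂x₂` of a function on the plane. -/
def pd2 {E : Type*} [NormedAddCommGroup E] [NormedSpace ℝ E] (h : ℝ × ℝ → E) : ℝ × ℝ → E :=
  fun p => fderiv ℝ h p (0, 1)

/-- The mixed partial derivative `D^α h = ∂^{α₁+α₂} h / ∂x₁^{α₁} ∂x₂^{α₂}`. -/
def mixedPD {E : Type*} [NormedAddCommGroup E] [NormedSpace ℝ E] (α : ℕ × ℕ)
    (h : ℝ × ℝ → E) : ℝ × ℝ → E :=
  pd1^[α.1] (pd2^[α.2] h)

/-- `h ∈ C^N(V̄)`, for an open set `V`: `h` is continuous on the closure of `V`, is of class `C^N`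
in `V`, and every partial derivative of order at most `N` extends continuously to the closure. The
values of `h` outside the closure of `V` are irrelevant. -/
def IsCkUpToBoundary {E : Type*} [NormedAddCommGroup E] [NormedSpace ℝ E] (N : ℕ)
    (V : Set (ℝ × ℝ)) (h : ℝ × ℝ → E) : Prop :=
  ContinuousOn h (closure V) ∧ ContDiffOn ℝ N h V ∧
    ∀ α : ℕ × ℕ, α.1 + α.2 ≤ N →
      ∃ G : ℝ × ℝ → E, ContinuousOn G (closure V) ∧ Set.EqOn G (mixedPD α h) V

/-- The `C^N` norm `sup_V ∑_{|α| ≤ N} |D^α h|` over an open set `V`. For bounded `V` and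
`h ∈ C^N(V̄)` this is the maximum over the closure of `V` of the sum of the absolute values of the
continuous extensions of the derivatives. -/
def ckNorm {E : Type*} [NormedAddCommGroup E] [NormedSpace ℝ E] (N : ℕ)
    (V : Set (ℝ × ℝ)) (h : ℝ × ℝ → E) : ℝ :=
  sSup ((fun x => ∑ k ∈ Finset.range (N + 1), ∑ α ∈ Finset.HasAntidiagonal.antidiagonal k,
    ‖mixedPD α h x‖) '' V)

/-- `a ∈ C^1_0(U)`: a (complex-valued) `C^1` function with compact support contained in `U`. -/
def IsC1Compact (U : Set (ℝ × ℝ)) (a : ℝ × ℝ → ℂ) : Prop :=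
  ContDiff ℝ 1 a ∧ HasCompactSupport a ∧ tsupport a ⊆ U

/-- The oscillatory integral `∫_U e^{i lam φ(x)} a(x) dx` with phase `φ` and amplitude `a`. -/
def oscIntegral (U : Set (ℝ × ℝ)) (lam : ℝ) (φ : ℝ × ℝ → ℝ) (a : ℝ × ℝ → ℂ) : ℂ :=
  ∫ x in U, Complex.exp (Complex.I * ((lam * φ x : ℝ) : ℂ)) * a x

end

/-! For (i), write the phase as φ = x₁x₂² + h with h = g + F. On a small square about the origin (a
ball of the sup norm) the second and third derivatives of h are small. Then φ₂₂ = 2x₁ + h₂₂ and φ₁₂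
= 2x₂ + h₁₂ vanish together at some point p₀ of the square, by the contraction principle
(`exists_mixedPD_eq_center`). With (X, Y) = p - p₀, the derivatives φ₂₂ and φ₁₂ are 2X and 2Y up to
a small multiple of max(|X|, |Y|), and φ₁₁ is κ = h₁₁(p₀) up to the same error.

No normal form is needed, only directions in which φ is curved. Where |Y| ≤ |X|, the vertical second
derivative is comparable to X. In each of the two cones |X| < ±Y, the second derivative along (ω, 1)
with ω = ±1 is κ + 4ωY + 2X plus errors; the sign of ω is chosen so that 4ωY has the sign of κ, and
4|Y| beats the remaining terms. In all three regions it is therefore at least half the distance |t -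
t₀| of the slice parameter t = x₁ - ωx₂ from its value at p₀. The second derivative test bounds the
slice integral by a multiple of (|λ||t - t₀|)^(-1/2), which is integrable in t
(`norm_oscIntegral_le_of_oblique`). The point p₀ moves with F, but the constants do not depend on
it.

For (ii), take a(x) = (b∗b)(x₁) b(x₂) with an even bump b. The x₁-integral is the square of the real
Fourier transform of b at λx₂², so nothing cancels in x₂, and the strip |x₂| ≤ |λ|^(-1/2) alone
contributes a multiple of |λ|^(-1/2). -/

/-! ### One-dimensional van der Corput estimates -/

/-- Van der Corput's first derivative test with a `C¹` amplitude. -/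
theorem norm_integral_exp_mul_le_of_le_abs_deriv {a b lam κ M M' : ℝ} (hab : a ≤ b)
    (hlam : lam ≠ 0) (hκ : 0 < κ) {ψ ψ' ψ'' : ℝ → ℝ} {A A' : ℝ → ℂ}
    (hψ : ∀ s ∈ Set.Icc a b, HasDerivAt ψ (ψ' s) s)
    (hψ' : ∀ s ∈ Set.Icc a b, HasDerivAt ψ' (ψ'' s) s)
    (hψ'' : ContinuousOn ψ'' (Set.Icc a b))
    (hA : ∀ s ∈ Set.Icc a b, HasDerivAt A (A' s) s) (hA' : ContinuousOn A' (Set.Icc a b))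
    (hM : ∀ s ∈ Set.Icc a b, ‖A s‖ ≤ M) (hM' : ∀ s ∈ Set.Icc a b, ‖A' s‖ ≤ M')
    (hpos : ∀ s ∈ Set.Icc a b, 0 ≤ ψ'' s) (hle : ∀ s ∈ Set.Icc a b, κ ≤ |ψ' s|) :
    ‖∫ s in a..b, Complex.exp (Complex.I * ((lam * ψ s : ℝ) : ℂ)) * A s‖
      ≤ (4 * M + M' * (b - a)) / (|lam| * κ) := by
  have hne : ∀ s ∈ Set.Icc a b, ψ' s ≠ 0 := fun s hs h0 => by
    have := hle s hs
    rw [h0, abs_zero] at this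
    linarith
  have hψc : ContinuousOn ψ (Set.Icc a b) := fun s hs => (hψ s hs).continuousAt.continuousWithinAt
  have hψ'c : ContinuousOn ψ' (Set.Icc a b) :=
    fun s hs => (hψ' s hs).continuousAt.continuousWithinAt
  have hAc : ContinuousOn A (Set.Icc a b) := fun s hs => (hA s hs).continuousAt.continuousWithinAt
  have hl : (lam : ℂ) ≠ 0 := by exact_mod_cast hlam
  have hM0 : 0 ≤ M := (norm_nonneg _).trans (hM a ⟨le_rfl, hab⟩)
  have hlp : 0 < |lam| := abs_pos.2 hlam
  -- Dividing the amplitude by iλψ' turns the integrand into `u * v'`, where `v'` is the derivative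
  -- of the exponential, ready for integration by parts.
  set u : ℝ → ℂ := fun s => A s * (Complex.I * lam * ψ' s)⁻¹ with hu
  set u' : ℝ → ℂ := fun s => A' s * (Complex.I * lam * ψ' s)⁻¹ +
    A s * (-(Complex.I * lam * ψ'' s) / (Complex.I * lam * ψ' s) ^ 2) with hu'
  set v : ℝ → ℂ := fun s => Complex.exp (Complex.I * ((lam * ψ s : ℝ) : ℂ)) with hv
  set v' : ℝ → ℂ := fun s => Complex.exp (Complex.I * ((lam * ψ s : ℝ) : ℂ)) *
    (Complex.I * ((lam * ψ' s : ℝ) : ℂ)) with hv'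
  have hden : ∀ s ∈ Set.Icc a b, Complex.I * lam * ψ' s ≠ 0 := fun s hs =>
    mul_ne_zero (mul_ne_zero Complex.I_ne_zero hl) (by exact_mod_cast hne s hs)
  have hud : ∀ s ∈ Set.uIcc a b, HasDerivAt u (u' s) s := by
    intro s hs
    rw [Set.uIcc_of_le hab] at hs
    have h1 : HasDerivAt (fun s => Complex.I * lam * (ψ' s : ℂ)) (Complex.I * lam * ψ'' s) s :=
      (hψ' s hs).ofReal_comp.const_mul _
    exact (hA s hs).mul (h1.inv (hden s hs))
  have hvd : ∀ s ∈ Set.uIcc a b, HasDerivAt v (v' s) s := by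
    intro s hs
    rw [Set.uIcc_of_le hab] at hs
    have h1 : HasDerivAt (fun s => ((lam * ψ s : ℝ) : ℂ)) ((lam * ψ' s : ℝ) : ℂ) s :=
      ((hψ s hs).const_mul lam).ofReal_comp
    exact (h1.const_mul Complex.I).cexp
  have hvc : ContinuousOn v (Set.Icc a b) := fun s hs =>
    (hvd s (by rwa [Set.uIcc_of_le hab])).continuousAt.continuousWithinAt
  have hψ'cC : ContinuousOn (fun s => (ψ' s : ℂ)) (Set.Icc a b) :=
    Complex.continuous_ofReal.comp_continuousOn hψ'c
  have hψ''cC : ContinuousOn (fun s => (ψ'' s : ℂ)) (Set.Icc a b) :=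
    Complex.continuous_ofReal.comp_continuousOn hψ''
  have hdc : ContinuousOn (fun s => Complex.I * lam * (ψ' s : ℂ)) (Set.Icc a b) :=
    continuousOn_const.mul hψ'cC
  have hu'c : ContinuousOn u' (Set.Icc a b) := by
    refine (hA'.mul (hdc.inv₀ hden)).add (hAc.mul (ContinuousOn.div ?_ (hdc.pow 2) ?_))
    · exact (continuousOn_const.mul hψ''cC).neg
    · exact fun s hs => pow_ne_zero _ (hden s hs)
  have hv'c : ContinuousOn v' (Set.Icc a b) := by
    refine hvc.mul (continuousOn_const.mul (Complex.continuous_ofReal.comp_continuousOn ?_))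
    exact continuousOn_const.mul hψ'c
  have hibp := intervalIntegral.integral_mul_deriv_eq_deriv_mul hud hvd
    ((by rwa [Set.uIcc_of_le hab] : ContinuousOn u' (Set.uIcc a b)).intervalIntegrable)
    ((by rwa [Set.uIcc_of_le hab] : ContinuousOn v' (Set.uIcc a b)).intervalIntegrable)
  have hcongr : ∫ s in a..b, Complex.exp (Complex.I * ((lam * ψ s : ℝ) : ℂ)) * A s =
      ∫ s in a..b, u s * v' s := by
    refine intervalIntegral.integral_congr fun s hs => ?_
    rw [Set.uIcc_of_le hab] at hs
    have h2 : (ψ' s : ℂ) ≠ 0 := by exact_mod_cast hne s hs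
    simp only [hu, hv']
    push_cast
    field_simp
  have hvn : ∀ s, ‖v s‖ = 1 := fun s => by
    simp only [hv]
    rw [mul_comm, Complex.norm_exp_ofReal_mul_I]
  have hun : ∀ s ∈ Set.Icc a b, ‖u s‖ ≤ M / (|lam| * κ) := by
    intro s hs
    simp only [hu, norm_mul, norm_inv, Complex.norm_I, one_mul, Complex.norm_real, Real.norm_eq_abs]
    rw [← div_eq_mul_inv]
    have := hle s hs
    have := hM s hs
    gcongr
  -- Since ψ'' ≥ 0, `w'` majorises the part of `u'` coming from the derivative of 1/ψ', and its
  -- integral telescopes. This costs 2M/(|λ|κ), as do the boundary terms; hence the 4M.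
  set w : ℝ → ℝ := fun s => -(M / |lam|) * (ψ' s)⁻¹ with hw
  set w' : ℝ → ℝ := fun s => -(M / |lam|) * (-(ψ'' s) / (ψ' s) ^ 2) with hw'
  have hwd : ∀ s ∈ Set.uIcc a b, HasDerivAt w (w' s) s := by
    intro s hs
    rw [Set.uIcc_of_le hab] at hs
    exact ((hψ' s hs).inv (hne s hs)).const_mul _
  have hw'c : ContinuousOn w' (Set.Icc a b) :=
    continuousOn_const.mul (hψ''.neg.div (hψ'c.pow 2) fun s hs => pow_ne_zero _ (hne s hs))
  have hw'i : IntervalIntegrable w' volume a b :=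
    (by rwa [Set.uIcc_of_le hab] : ContinuousOn w' (Set.uIcc a b)).intervalIntegrable
  have hftc := intervalIntegral.integral_eq_sub_of_hasDerivAt hwd hw'i
  have hwn : ∀ s ∈ Set.Icc a b, |w s| ≤ M / (|lam| * κ) := by
    intro s hs
    simp only [hw, abs_mul, abs_neg, abs_inv, abs_div, abs_abs, abs_of_nonneg hM0]
    rw [← div_eq_mul_inv, div_div]
    have := hle s hs
    gcongr
  have hbound : ‖∫ s in a..b, u' s * v s‖ ≤ ∫ s in a..b, (M' / (|lam| * κ) + w' s) := by
    refine intervalIntegral.norm_integral_le_of_norm_le hab (ae_of_all _ fun s hs => ?_)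
      (intervalIntegrable_const.add hw'i)
    have hs' : s ∈ Set.Icc a b := ⟨hs.1.le, hs.2⟩
    rw [norm_mul, hvn, mul_one]
    refine (norm_add_le _ _).trans (add_le_add ?_ ?_)
    · simp only [norm_mul, norm_inv, Complex.norm_I, one_mul, Complex.norm_real, Real.norm_eq_abs]
      rw [← div_eq_mul_inv]
      have := hle s hs'
      have := hM' s hs'
      have : 0 ≤ M' := (norm_nonneg _).trans this
      gcongr
    · have e : w' s = M * (|lam| * ψ'' s / (|lam| * |ψ' s|) ^ 2) := by
        simp only [hw']
        rw [mul_pow, sq_abs (ψ' s)]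
        have := hne s hs'
        field_simp
      rw [e]
      simp only [norm_mul, norm_div, norm_neg, norm_pow, Complex.norm_I, one_mul,
        Complex.norm_real, Real.norm_eq_abs, abs_of_nonneg (hpos s hs')]
      have := hpos s hs'
      have := hM s hs'
      gcongr
  rw [intervalIntegral.integral_add intervalIntegrable_const hw'i, hftc,
    intervalIntegral.integral_const, smul_eq_mul] at hbound
  rw [hcongr, hibp]
  have ha : a ∈ Set.Icc a b := ⟨le_rfl, hab⟩
  have hb : b ∈ Set.Icc a b := ⟨hab, le_rfl⟩
  have h1 : ‖u b * v b‖ ≤ M / (|lam| * κ) := by rw [norm_mul, hvn, mul_one]; exact hun b hb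
  have h2 : ‖u a * v a‖ ≤ M / (|lam| * κ) := by rw [norm_mul, hvn, mul_one]; exact hun a ha
  have h3 := abs_le.1 (hwn a ha)
  have h4 := abs_le.1 (hwn b hb)
  have h5 := norm_sub_le (u b * v b - u a * v a) (∫ s in a..b, u' s * v s)
  have h6 := norm_sub_le (u b * v b) (u a * v a)
  have e : (4 * M + M' * (b - a)) / (|lam| * κ) =
      4 * (M / (|lam| * κ)) + (b - a) * (M' / (|lam| * κ)) := by ring
  rw [e]
  linarith

/-- The point c is the zero of the increasing function ψ or, if it has none, the endpoint where |ψ|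
is least. -/
theorem exists_le_sub_of_le_sub {a b μ : ℝ} (hab : a ≤ b) {ψ : ℝ → ℝ}
    (hψ : ContinuousOn ψ (Set.Icc a b))
    (hmono : ∀ s ∈ Set.Icc a b, ∀ t ∈ Set.Icc a b, s ≤ t → μ * (t - s) ≤ ψ t - ψ s) :
    ∃ c ∈ Set.Icc a b, ∀ s ∈ Set.Icc a b, s ≠ c → μ * |s - c| ≤ |ψ s| := by
  have ha : a ∈ Set.Icc a b := ⟨le_rfl, hab⟩
  have hb : b ∈ Set.Icc a b := ⟨hab, le_rfl⟩
  rcases le_or_gt 0 (ψ a) with h0 | h0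
  · refine ⟨a, ha, fun s hs _ => ?_⟩
    rw [abs_of_nonneg (sub_nonneg.2 hs.1)]
    exact (by linarith [hmono a ha s hs hs.1] : _ ≤ ψ s).trans (le_abs_self _)
  rcases le_or_gt (ψ b) 0 with h1 | h1
  · refine ⟨b, hb, fun s hs _ => ?_⟩
    rw [abs_of_nonpos (sub_nonpos.2 hs.2)]
    exact (by linarith [hmono s hs b hb hs.2] : _ ≤ -ψ s).trans (neg_le_abs _)
  obtain ⟨c, hc, hc0⟩ := intermediate_value_Icc hab hψ ⟨h0.le, h1.le⟩
  refine ⟨c, hc, fun s hs _ => ?_⟩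
  rcases le_total c s with h | h
  · rw [abs_of_nonneg (sub_nonneg.2 h)]
    exact (by linarith [hmono c hc s hs h] : _ ≤ ψ s).trans (le_abs_self _)
  · rw [abs_of_nonpos (sub_nonpos.2 h)]
    exact (by linarith [hmono s hs c hc h] : _ ≤ -ψ s).trans (neg_le_abs _)

/-- ψ' grows at rate at least μ away from one point c. The interval of radius ρ around c is
estimated trivially; on either side |ψ'| ≥ μρ and the first derivative test applies. -/
theorem norm_integral_exp_mul_le_of_le_snd_deriv {a b lam μ M M' : ℝ} (hab : a ≤ b)
    (hlam : lam ≠ 0) (hμ : 0 < μ) {ψ ψ' ψ'' : ℝ → ℝ} {A A' : ℝ → ℂ}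
    (hψ : ∀ s ∈ Set.Icc a b, HasDerivAt ψ (ψ' s) s)
    (hψ' : ∀ s ∈ Set.Icc a b, HasDerivAt ψ' (ψ'' s) s)
    (hψ'' : ContinuousOn ψ'' (Set.Icc a b))
    (hA : ∀ s ∈ Set.Icc a b, HasDerivAt A (A' s) s) (hA' : ContinuousOn A' (Set.Icc a b))
    (hM : ∀ s ∈ Set.Icc a b, ‖A s‖ ≤ M) (hM' : ∀ s ∈ Set.Icc a b, ‖A' s‖ ≤ M')
    (hle : ∀ s ∈ Set.Icc a b, μ ≤ ψ'' s) :
    ‖∫ s in a..b, Complex.exp (Complex.I * ((lam * ψ s : ℝ) : ℂ)) * A s‖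
      ≤ (10 * M + 2 * M' * (b - a)) / √(|lam| * μ) := by
  have hψc : ContinuousOn ψ (Set.Icc a b) := fun s hs => (hψ s hs).continuousAt.continuousWithinAt
  have hψ'c : ContinuousOn ψ' (Set.Icc a b) :=
    fun s hs => (hψ' s hs).continuousAt.continuousWithinAt
  have hAc : ContinuousOn A (Set.Icc a b) := fun s hs => (hA s hs).continuousAt.continuousWithinAt
  have hM0 : 0 ≤ M := (norm_nonneg _).trans (hM a ⟨le_rfl, hab⟩)
  have hM0' : 0 ≤ M' := (norm_nonneg _).trans (hM' a ⟨le_rfl, hab⟩)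
  have hlp : 0 < |lam| := abs_pos.2 hlam
  have hmono : ∀ s ∈ Set.Icc a b, ∀ t ∈ Set.Icc a b, s ≤ t → μ * (t - s) ≤ ψ' t - ψ' s := by
    intro s hs t ht hst
    refine Convex.mul_sub_le_image_sub_of_le_deriv (convex_Icc a b) hψ'c ?_ ?_ s hs t ht hst
    · exact fun x hx => (hψ' x (interior_subset hx)).differentiableAt.differentiableWithinAt
    · intro x hx
      rw [(hψ' x (interior_subset hx)).deriv]
      exact hle x (interior_subset hx)
  obtain ⟨c, hc, hcle⟩ := exists_le_sub_of_le_sub hab hψ'c hmono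
  set R := √(|lam| * μ) with hR
  have hR0 : 0 < R := Real.sqrt_pos.2 (mul_pos hlp hμ)
  have hRR : R * R = |lam| * μ := Real.mul_self_sqrt (mul_pos hlp hμ).le
  -- This radius balances the pieces: 2Mρ = 2M/R in the middle and (4M + M'(b - a))/R on each side.
  set ρ := 1 / R with hρ
  have hρ0 : 0 < ρ := by positivity
  have hlR : |lam| * (μ * ρ) = R := by
    rw [← mul_assoc, ← hRR, hρ]
    field_simp
  set G : ℝ → ℂ := fun s => Complex.exp (Complex.I * ((lam * ψ s : ℝ) : ℂ)) * A s with hG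
  have hGc : ContinuousOn G (Set.Icc a b) := by
    refine ContinuousOn.mul (Complex.continuous_exp.comp_continuousOn
      (continuousOn_const.mul (Complex.continuous_ofReal.comp_continuousOn ?_))) hAc
    exact continuousOn_const.mul hψc
  set p := max a (c - ρ) with hp
  set q := min b (c + ρ) with hq
  have hap : a ≤ p := le_max_left _ _
  have hpc : p ≤ c := max_le hc.1 (by linarith)
  have hcq : c ≤ q := le_min hc.2 (by linarith)
  have hqb : q ≤ b := min_le_left _ _
  have hint : ∀ s t, a ≤ s → s ≤ t → t ≤ b → IntervalIntegrable G volume s t := by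
    intro s t h1 h2 h3
    refine ContinuousOn.intervalIntegrable (hGc.mono ?_)
    rw [Set.uIcc_of_le h2]
    exact Set.Icc_subset_Icc h1 h3
  have hside : ∀ s t, a ≤ s → s ≤ t → t ≤ b → (∀ x ∈ Set.Icc s t, ρ ≤ |x - c|) →
      ‖∫ x in s..t, G x‖ ≤ (4 * M + M' * (b - a)) / R := by
    intro s t h1 h2 h3 h4
    have hsub : Set.Icc s t ⊆ Set.Icc a b := Set.Icc_subset_Icc h1 h3
    rw [← hlR]
    refine (norm_integral_exp_mul_le_of_le_abs_deriv h2 hlam (mul_pos hμ hρ0)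
      (fun x hx => hψ x (hsub hx)) (fun x hx => hψ' x (hsub hx)) (hψ''.mono hsub)
      (fun x hx => hA x (hsub hx)) (hA'.mono hsub) (fun x hx => hM x (hsub hx))
      (fun x hx => hM' x (hsub hx)) (fun x hx => hμ.le.trans (hle x (hsub hx))) ?_).trans ?_
    · intro x hx
      refine (mul_le_mul_of_nonneg_left (h4 x hx) hμ.le).trans (hcle x (hsub hx) ?_)
      rintro rfl
      have := h4 x hx
      rw [sub_self, abs_zero] at this
      linarith
    · gcongr
  have hleft : ‖∫ x in a..p, G x‖ ≤ (4 * M + M' * (b - a)) / R := by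
    rcases le_or_gt (c - ρ) a with h | h
    · have : p = a := max_eq_left h
      rw [this, intervalIntegral.integral_same, norm_zero]
      have := sub_nonneg.2 hab
      positivity
    · have : p = c - ρ := max_eq_right h.le
      refine hside a p le_rfl hap (hpc.trans hc.2) fun x hx => ?_
      rw [this] at hx
      rw [abs_sub_comm]
      exact (by linarith [hx.2] : ρ ≤ c - x).trans (le_abs_self _)
  have hright : ‖∫ x in q..b, G x‖ ≤ (4 * M + M' * (b - a)) / R := by
    rcases le_or_gt b (c + ρ) with h | h
    · have : q = b := min_eq_left h
      rw [this, intervalIntegral.integral_same, norm_zero]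
      have := sub_nonneg.2 hab
      positivity
    · have : q = c + ρ := min_eq_right h.le
      refine hside q b (hc.1.trans hcq) hqb le_rfl fun x hx => ?_
      rw [this] at hx
      exact (by linarith [hx.1] : ρ ≤ x - c).trans (le_abs_self _)
  have hmid : ‖∫ x in p..q, G x‖ ≤ M * (2 * ρ) := by
    have hpq := hpc.trans hcq
    refine (intervalIntegral.norm_integral_le_of_norm_le_const (C := M) fun x hx => ?_).trans ?_
    · rw [Set.uIoc_of_le hpq] at hx
      simp only [hG]
      rw [norm_mul, mul_comm Complex.I, Complex.norm_exp_ofReal_mul_I, one_mul]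
      exact hM x ⟨hap.trans hx.1.le, hx.2.trans hqb⟩
    · rw [abs_of_nonneg (sub_nonneg.2 hpq)]
      have h1 : c - ρ ≤ p := le_max_right _ _
      have h2 : q ≤ c + ρ := min_le_right _ _
      gcongr
      linarith
  rw [← intervalIntegral.integral_add_adjacent_intervals
      (hint a p le_rfl hap (hpc.trans hc.2)) (hint p b hap (hpc.trans hc.2) le_rfl),
    ← intervalIntegral.integral_add_adjacent_intervals
      (hint p q hap (hpc.trans hcq) hqb) (hint q b (hc.1.trans hcq) hqb le_rfl)]
  have h5 := norm_add_le (∫ x in a..p, G x) ((∫ x in p..q, G x) + ∫ x in q..b, G x)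
  have h6 := norm_add_le (∫ x in p..q, G x) (∫ x in q..b, G x)
  have e : (10 * M + 2 * M' * (b - a)) / R = 2 * ((4 * M + M' * (b - a)) / R) + M * (2 * ρ) := by
    rw [hρ]; ring
  rw [e]
  linarith

/-- Van der Corput's second derivative test with a `C¹` amplitude. -/
theorem norm_integral_exp_mul_le_of_le_abs_snd_deriv {a b lam μ M M' : ℝ} (hab : a ≤ b)
    (hlam : lam ≠ 0) (hμ : 0 < μ) {ψ ψ' ψ'' : ℝ → ℝ} {A A' : ℝ → ℂ}
    (hψ : ∀ s ∈ Set.Icc a b, HasDerivAt ψ (ψ' s) s)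
    (hψ' : ∀ s ∈ Set.Icc a b, HasDerivAt ψ' (ψ'' s) s)
    (hψ'' : ContinuousOn ψ'' (Set.Icc a b))
    (hA : ∀ s ∈ Set.Icc a b, HasDerivAt A (A' s) s) (hA' : ContinuousOn A' (Set.Icc a b))
    (hM : ∀ s ∈ Set.Icc a b, ‖A s‖ ≤ M) (hM' : ∀ s ∈ Set.Icc a b, ‖A' s‖ ≤ M')
    (hle : ∀ s ∈ Set.Icc a b, μ ≤ |ψ'' s|) :
    ‖∫ s in a..b, Complex.exp (Complex.I * ((lam * ψ s : ℝ) : ℂ)) * A s‖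
      ≤ (10 * M + 2 * M' * (b - a)) / √(|lam| * μ) := by
  -- A continuous ψ'' bounded away from zero has constant sign; a negative sign is absorbed by
  -- negating both λ and ψ.
  have hsign : (∀ s ∈ Set.Icc a b, 0 < ψ'' s) ∨ (∀ s ∈ Set.Icc a b, ψ'' s < 0) := by
    by_contra! hcon
    obtain ⟨⟨s, hs, hs0⟩, t, ht, ht0⟩ := hcon
    obtain ⟨x, hx, hx0⟩ := isPreconnected_Icc.intermediate_value hs ht hψ'' ⟨hs0, ht0⟩
    have := hle x hx
    rw [hx0, abs_zero] at this
    linarith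
  rcases hsign with h | h
  · refine norm_integral_exp_mul_le_of_le_snd_deriv hab hlam hμ hψ hψ' hψ'' hA hA' hM hM' ?_
    exact fun s hs => (hle s hs).trans_eq (abs_of_pos (h s hs))
  · have := norm_integral_exp_mul_le_of_le_snd_deriv hab (neg_ne_zero.2 hlam) hμ
      (fun s hs => (hψ s hs).neg) (fun s hs => (hψ' s hs).neg) hψ''.neg hA hA' hM hM'
      (fun s hs => (hle s hs).trans_eq (abs_of_neg (h s hs)))
    simpa only [Pi.neg_apply, neg_mul_neg, abs_neg] using this

/-! ### Calculus of iterated partial derivatives and the norms -/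

section PartialDerivatives

variable {E : Type*} [NormedAddCommGroup E] [NormedSpace ℝ E] {V : Set (ℝ × ℝ)}

theorem contDiffOn_pd1 (hV : IsOpen V) {n m : ℕ} (hnm : m + 1 ≤ n) {h : ℝ × ℝ → E}
    (hh : ContDiffOn ℝ n h V) : ContDiffOn ℝ m (pd1 h) V :=
  (hh.fderiv_of_isOpen hV (by exact_mod_cast hnm)).clm_apply contDiffOn_const

theorem contDiffOn_pd2 (hV : IsOpen V) {n m : ℕ} (hnm : m + 1 ≤ n) {h : ℝ × ℝ → E}
    (hh : ContDiffOn ℝ n h V) : ContDiffOn ℝ m (pd2 h) V :=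
  (hh.fderiv_of_isOpen hV (by exact_mod_cast hnm)).clm_apply contDiffOn_const

theorem eqOn_pd1 (hV : IsOpen V) {h k : ℝ × ℝ → E} (hhk : Set.EqOn h k V) :
    Set.EqOn (pd1 h) (pd1 k) V := fun x hx => by
  simp only [pd1, (hhk.eventuallyEq_of_mem (hV.mem_nhds hx)).fderiv_eq]

theorem eqOn_pd2 (hV : IsOpen V) {h k : ℝ × ℝ → E} (hhk : Set.EqOn h k V) :
    Set.EqOn (pd2 h) (pd2 k) V := fun x hx => by
  simp only [pd2, (hhk.eventuallyEq_of_mem (hV.mem_nhds hx)).fderiv_eq]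

theorem contDiffOn_pd2_iterate (hV : IsOpen V) (j : ℕ) {n m : ℕ} (hnm : m + j ≤ n)
    {h : ℝ × ℝ → E} (hh : ContDiffOn ℝ n h V) : ContDiffOn ℝ m (pd2^[j] h) V := by
  induction j generalizing m with
  | zero => exact hh.of_le (by exact_mod_cast hnm)
  | succ j ih =>
    rw [Function.iterate_succ_apply']
    exact contDiffOn_pd2 hV le_rfl (ih (m := m + 1) (by lia))

theorem contDiffOn_mixedPD (hV : IsOpen V) (α : ℕ × ℕ) {n m : ℕ} (hnm : m + (α.1 + α.2) ≤ n)
    {h : ℝ × ℝ → E} (hh : ContDiffOn ℝ n h V) : ContDiffOn ℝ m (mixedPD α h) V := by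
  obtain ⟨i, j⟩ := α
  induction i generalizing m with
  | zero => exact contDiffOn_pd2_iterate hV j (by simpa using hnm) hh
  | succ i ih =>
    simp only [mixedPD, Function.iterate_succ_apply']
    exact contDiffOn_pd1 hV le_rfl (ih (m := m + 1) (by simp only at hnm ⊢; lia))

theorem eqOn_mixedPD (hV : IsOpen V) (α : ℕ × ℕ) {h k : ℝ × ℝ → E} (hhk : Set.EqOn h k V) :
    Set.EqOn (mixedPD α h) (mixedPD α k) V := by
  obtain ⟨i, j⟩ := α
  induction i with
  | zero =>
    induction j with
    | zero => exact hhk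
    | succ j ih =>
      simp only [mixedPD, Function.iterate_succ_apply', Function.iterate_zero, id] at ih ⊢
      exact eqOn_pd2 hV ih
  | succ i ih =>
    simp only [mixedPD, Function.iterate_succ_apply'] at ih ⊢
    exact eqOn_pd1 hV ih

theorem mixedPD_add (hV : IsOpen V) (α : ℕ × ℕ) {n : ℕ} (hn : α.1 + α.2 ≤ n)
    {h k : ℝ × ℝ → E} (hh : ContDiffOn ℝ n h V) (hk : ContDiffOn ℝ n k V) :
    Set.EqOn (mixedPD α (h + k)) (mixedPD α h + mixedPD α k) V := by
  have hdiff : ∀ {l : ℝ × ℝ → E}, ContDiffOn ℝ (1 : ℕ) l V → ∀ x ∈ V, DifferentiableAt ℝ l x :=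
    fun hl x hx => (hl.contDiffAt (hV.mem_nhds hx)).differentiableAt (by simp)
  obtain ⟨i, j⟩ := α
  induction i with
  | zero =>
    induction j with
    | zero => exact fun x _ => rfl
    | succ j ih =>
      simp only [mixedPD, Function.iterate_succ_apply', Function.iterate_zero, id] at ih hn ⊢
      intro x hx
      rw [eqOn_pd2 hV (ih (by lia)) hx]
      have h1 := hdiff (contDiffOn_pd2_iterate hV j (by lia) hh) x hx
      have h2 := hdiff (contDiffOn_pd2_iterate hV j (by lia) hk) x hx
      simp only [pd2, fderiv_add h1 h2, Pi.add_apply]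
      rfl
  | succ i ih =>
    have h1 := hdiff (contDiffOn_mixedPD hV (i, j) (by simp only at hn ⊢; lia) hh)
    have h2 := hdiff (contDiffOn_mixedPD hV (i, j) (by simp only at hn ⊢; lia) hk)
    simp only [mixedPD, Function.iterate_succ_apply'] at ih hn h1 h2 ⊢
    intro x hx
    rw [eqOn_pd1 hV (ih (by lia)) hx]
    simp only [pd1] at h1 h2 ⊢
    rw [fderiv_add (h1 x hx) (h2 x hx)]
    rfl

theorem pd1_mixedPD (i j : ℕ) (h : ℝ × ℝ → E) : pd1 (mixedPD (i, j) h) = mixedPD (i + 1, j) h := by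
  simp only [mixedPD, Function.iterate_succ_apply']

theorem pd2_pd1 (hV : IsOpen V) {h : ℝ × ℝ → E} (hh : ContDiffOn ℝ (2 : ℕ) h V) :
    Set.EqOn (pd2 (pd1 h)) (pd1 (pd2 h)) V := by
  intro x hx
  have hat := hh.contDiffAt (hV.mem_nhds hx)
  have hsymm := hat.isSymmSndFDerivAt (by simp)
  have hd : DifferentiableAt ℝ (fderiv ℝ h) x :=
    (hat.fderiv_right (m := 1) (by norm_num)).differentiableAt (by simp)
  have hc : ∀ v w, fderiv ℝ (fun p => fderiv ℝ h p v) x w = fderiv ℝ (fderiv ℝ h) x w v := by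
    intro v w
    rw [fderiv_clm_apply hd (differentiableAt_const v)]
    simp
  exact (hc (1, 0) (0, 1)).trans ((hsymm _ _).trans (hc (0, 1) (1, 0)).symm)

/-- `mixedPD` applies the x₂-derivatives first, so an outer `pd2` has to be commuted past every
`pd1`. -/
theorem pd2_mixedPD (hV : IsOpen V) (i j : ℕ) {n : ℕ} (hn : i + j + 1 ≤ n) {h : ℝ × ℝ → E}
    (hh : ContDiffOn ℝ n h V) :
    Set.EqOn (pd2 (mixedPD (i, j) h)) (mixedPD (i, j + 1) h) V := by
  induction i with
  | zero =>
    intro x _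
    simp only [mixedPD, Function.iterate_succ_apply', Function.iterate_zero, id]
  | succ i ih =>
    rw [← pd1_mixedPD, ← pd1_mixedPD]
    exact (pd2_pd1 hV (contDiffOn_mixedPD hV (i, j) (by simp only; lia) hh)).trans
      (eqOn_pd1 hV (ih (by lia)))

theorem fderiv_apply_eq_pd (h : ℝ × ℝ → E) (p v : ℝ × ℝ) :
    fderiv ℝ h p v = v.1 • pd1 h p + v.2 • pd2 h p := by
  have : v = v.1 • ((1, 0) : ℝ × ℝ) + v.2 • ((0, 1) : ℝ × ℝ) := by ext <;> simp
  conv_lhs => rw [this]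
  rw [map_add, map_smul, map_smul]
  rfl

theorem norm_fderiv_le_pd (h : ℝ × ℝ → E) (p : ℝ × ℝ) :
    ‖fderiv ℝ h p‖ ≤ ‖pd1 h p‖ + ‖pd2 h p‖ := by
  refine ContinuousLinearMap.opNorm_le_bound _ (by positivity) fun v => ?_
  rw [fderiv_apply_eq_pd]
  refine (norm_add_le _ _).trans ?_
  rw [norm_smul, norm_smul, add_mul, mul_comm ‖pd1 h p‖, mul_comm ‖pd2 h p‖]
  have := norm_fst_le v
  have := norm_snd_le v
  gcongr

/-- Mean value inequality; the factor 2 arises because, for the sup norm on the plane, the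
derivative is bounded by the sum of the two partials. -/
theorem norm_mixedPD_sub_le (hV : IsOpen V) {s : Set (ℝ × ℝ)} (hs : Convex ℝ s) (hsV : s ⊆ V)
    (α : ℕ × ℕ) {n : ℕ} (hn : α.1 + α.2 + 1 ≤ n) {h : ℝ × ℝ → E} (hh : ContDiffOn ℝ n h V) {δ : ℝ}
    (hδ : ∀ β : ℕ × ℕ, β.1 + β.2 = α.1 + α.2 + 1 → ∀ x ∈ s, ‖mixedPD β h x‖ ≤ δ)
    {p q : ℝ × ℝ} (hp : p ∈ s) (hq : q ∈ s) :
    ‖mixedPD α h p - mixedPD α h q‖ ≤ 2 * δ * ‖p - q‖ := by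
  obtain ⟨i, j⟩ := α
  refine hs.norm_image_sub_le_of_norm_fderiv_le (𝕜 := ℝ) (fun x hx => ?_) (fun x hx => ?_) hq hp
  · exact ((contDiffOn_mixedPD hV (i, j) (m := 1) (by simp only at hn ⊢; lia) hh).contDiffAt
      (hV.mem_nhds (hsV hx))).differentiableAt (by simp)
  · refine (norm_fderiv_le_pd _ _).trans ?_
    rw [pd1_mixedPD, pd2_mixedPD hV i j hn hh (hsV hx), two_mul]
    exact add_le_add (hδ (i + 1, j) (by simp only; lia) x hx)
      (hδ (i, j + 1) (by simp only; lia) x hx)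

theorem hasDerivAt_comp_line {k : ℝ × ℝ → E} (t ω s : ℝ)
    (hk : DifferentiableAt ℝ k (t + ω * s, s)) :
    HasDerivAt (fun s => k (t + ω * s, s))
      (ω • pd1 k (t + ω * s, s) + pd2 k (t + ω * s, s)) s := by
  have h1 : HasDerivAt (fun s : ℝ => (t + ω * s, s)) ((ω, 1) : ℝ × ℝ) s := by
    refine HasDerivAt.prodMk ?_ (hasDerivAt_id s)
    simpa using ((hasDerivAt_id s).const_mul ω).const_add t
  have h2 := hk.hasFDerivAt.comp_hasDerivAt (f := fun s : ℝ => (t + ω * s, s)) s h1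
  rw [fderiv_apply_eq_pd, one_smul] at h2
  exact h2

/-- Each derivative occurring in the `C^N` norm is bounded by that norm. -/
theorem norm_mixedPD_le_ckNorm {N : ℕ} (hVb : Bornology.IsBounded V) {h : ℝ × ℝ → E}
    (hh : IsCkUpToBoundary N V h) {α : ℕ × ℕ} (hα : α.1 + α.2 ≤ N) {x : ℝ × ℝ} (hx : x ∈ V) :
    ‖mixedPD α h x‖ ≤ ckNorm N V h := by
  have hbdd : ∀ α : ℕ × ℕ, ∃ B : ℝ, α.1 + α.2 ≤ N → ∀ x ∈ V, ‖mixedPD α h x‖ ≤ B := by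
    intro α
    by_cases hα : α.1 + α.2 ≤ N
    · obtain ⟨G, hG, hGe⟩ := hh.2.2 α hα
      obtain ⟨B, hB⟩ := hVb.isCompact_closure.exists_bound_of_continuousOn hG
      exact ⟨B, fun _ x hx => hGe hx ▸ hB x (subset_closure hx)⟩
    · exact ⟨0, fun h => absurd h hα⟩
  choose B hB using hbdd
  have hbd : BddAbove ((fun x => ∑ k ∈ Finset.range (N + 1),
      ∑ α ∈ Finset.HasAntidiagonal.antidiagonal k, ‖mixedPD α h x‖) '' V) := by
    refine ⟨∑ k ∈ Finset.range (N + 1), ∑ α ∈ Finset.HasAntidiagonal.antidiagonal k, B α, ?_⟩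
    rintro _ ⟨y, hy, rfl⟩
    refine Finset.sum_le_sum fun k hk => Finset.sum_le_sum fun β hβ => hB β ?_ y hy
    rw [Finset.HasAntidiagonal.mem_antidiagonal.1 hβ]
    exact Nat.lt_succ_iff.1 (Finset.mem_range.1 hk)
  refine le_trans ?_ (le_csSup hbd ⟨x, hx, rfl⟩)
  refine le_trans ?_ (Finset.single_le_sum
    (f := fun k => ∑ α ∈ Finset.HasAntidiagonal.antidiagonal k, ‖mixedPD α h x‖)
    (fun k _ => Finset.sum_nonneg fun _ _ => norm_nonneg _)
    (Finset.mem_range.2 (Nat.lt_succ_iff.2 hα)))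
  exact Finset.single_le_sum (f := fun β => ‖mixedPD β h x‖) (fun _ _ => norm_nonneg _)
    (Finset.HasAntidiagonal.mem_antidiagonal.2 rfl)

end PartialDerivatives

theorem IsC1Compact.isCkUpToBoundary {U : Set (ℝ × ℝ)} {a : ℝ × ℝ → ℂ} (ha : IsC1Compact U a) :
    IsCkUpToBoundary 1 U a := by
  refine ⟨ha.1.continuous.continuousOn, ha.1.contDiffOn, fun α hα => ⟨mixedPD α a, ?_, fun _ _ => rfl⟩⟩
  exact (contDiffOn_mixedPD isOpen_univ α (n := 1) (m := 0) (by lia)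
    (by exact_mod_cast ha.1.contDiffOn)).continuousOn.mono (Set.subset_univ _)

/-- The `C¹` norm of a compactly supported amplitude bounds it and its derivatives everywhere. -/
theorem IsC1Compact.norm_le {U : Set (ℝ × ℝ)} (hUb : Bornology.IsBounded U) {a : ℝ × ℝ → ℂ}
    (ha : IsC1Compact U a) (x : ℝ × ℝ) (hne : U.Nonempty) :
    ‖a x‖ ≤ ckNorm 1 U a ∧ ‖pd1 a x‖ ≤ ckNorm 1 U a ∧ ‖pd2 a x‖ ≤ ckNorm 1 U a := by
  by_cases hx : x ∈ U
  · exact ⟨norm_mixedPD_le_ckNorm hUb ha.isCkUpToBoundary (α := (0, 0)) (by simp) hx,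
      norm_mixedPD_le_ckNorm hUb ha.isCkUpToBoundary (α := (1, 0)) (by simp) hx,
      norm_mixedPD_le_ckNorm hUb ha.isCkUpToBoundary (α := (0, 1)) (by simp) hx⟩
  · obtain ⟨y, hy⟩ := hne
    have h0 : 0 ≤ ckNorm 1 U a := (norm_nonneg _).trans
      (norm_mixedPD_le_ckNorm hUb ha.isCkUpToBoundary (α := (0, 0)) (by simp) hy)
    have hx' : x ∉ tsupport a := fun h => hx (ha.2.2 h)
    have hf : fderiv ℝ a x = 0 := by
      by_contra h
      exact hx' (support_fderiv_subset ℝ h)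
    simp [pd1, pd2, hf, image_eq_zero_of_notMem_tsupport hx', h0]

/-! ### Second derivatives of the model phase -/

section Model

theorem hasFDerivAt_fst_mul_snd_sq (p : ℝ × ℝ) : HasFDerivAt (fun x : ℝ × ℝ => x.1 * x.2 ^ 2)
    (p.1 • ((2 : ℕ) • p.2 ^ (2 - 1)) • ContinuousLinearMap.snd ℝ ℝ ℝ +
      (p.2 ^ 2) • ContinuousLinearMap.fst ℝ ℝ ℝ) p := by
  have h1 : HasFDerivAt (fun x : ℝ × ℝ => x.1) (ContinuousLinearMap.fst ℝ ℝ ℝ) p := hasFDerivAt_fst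
  have h2 : HasFDerivAt (fun x : ℝ × ℝ => x.2) (ContinuousLinearMap.snd ℝ ℝ ℝ) p := hasFDerivAt_snd
  exact h1.fun_mul (h2.pow 2)

theorem pd1_model : pd1 (fun x : ℝ × ℝ => x.1 * x.2 ^ 2) = fun x => x.2 ^ 2 := by
  ext p
  simp [pd1, (hasFDerivAt_fst_mul_snd_sq p).fderiv]

theorem pd2_model : pd2 (fun x : ℝ × ℝ => x.1 * x.2 ^ 2) = fun x => 2 * x.1 * x.2 := by
  ext p
  simp [pd2, (hasFDerivAt_fst_mul_snd_sq p).fderiv]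
  ring

theorem mixedPD_two_zero_model : mixedPD (2, 0) (fun x : ℝ × ℝ => x.1 * x.2 ^ 2) = 0 := by
  change pd1 (pd1 fun x : ℝ × ℝ => x.1 * x.2 ^ 2) = _
  rw [pd1_model]
  ext p
  have h2 : HasFDerivAt (fun x : ℝ × ℝ => x.2) (ContinuousLinearMap.snd ℝ ℝ ℝ) p := hasFDerivAt_snd
  simp [pd1, (h2.pow 2).fderiv]

theorem mixedPD_one_one_model :
    mixedPD (1, 1) (fun x : ℝ × ℝ => x.1 * x.2 ^ 2) = fun x => 2 * x.2 := by
  change pd1 (pd2 fun x : ℝ × ℝ => x.1 * x.2 ^ 2) = _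
  rw [pd2_model]
  ext p
  have h1 : HasFDerivAt (fun x : ℝ × ℝ => x.1) (ContinuousLinearMap.fst ℝ ℝ ℝ) p := hasFDerivAt_fst
  have h2 : HasFDerivAt (fun x : ℝ × ℝ => x.2) (ContinuousLinearMap.snd ℝ ℝ ℝ) p := hasFDerivAt_snd
  simp [pd1, ((h1.const_mul 2).fun_mul h2).fderiv]
  ring

theorem mixedPD_zero_two_model :
    mixedPD (0, 2) (fun x : ℝ × ℝ => x.1 * x.2 ^ 2) = fun x => 2 * x.1 := by
  change pd2 (pd2 fun x : ℝ × ℝ => x.1 * x.2 ^ 2) = _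
  rw [pd2_model]
  ext p
  have h1 : HasFDerivAt (fun x : ℝ × ℝ => x.1) (ContinuousLinearMap.fst ℝ ℝ ℝ) p := hasFDerivAt_fst
  have h2 : HasFDerivAt (fun x : ℝ × ℝ => x.2) (ContinuousLinearMap.snd ℝ ℝ ℝ) p := hasFDerivAt_snd
  simp [pd2, ((h1.const_mul 2).fun_mul h2).fderiv]

end Model

/-! ### Integration over oblique slices -/

/-- Slices of the regions are intervals that may lack endpoints. They agree almost everywhere with a
half-open interval, and the test needs its hypotheses on the closed one, hence the closures. -/
theorem norm_setIntegral_exp_mul_le {J : Set ℝ} (hJ : J.OrdConnected) {r lam μ M M' : ℝ}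
    (hJr : J ⊆ Set.Icc (-r) r) (hr : 0 ≤ r) (hlam : lam ≠ 0) (hμ : 0 < μ) (hM0 : 0 ≤ M)
    (hM0' : 0 ≤ M') {ψ ψ' ψ'' : ℝ → ℝ} {A A' : ℝ → ℂ}
    (hψ : ∀ s ∈ closure J, HasDerivAt ψ (ψ' s) s)
    (hψ' : ∀ s ∈ closure J, HasDerivAt ψ' (ψ'' s) s)
    (hψ'' : ContinuousOn ψ'' (closure J))
    (hA : ∀ s ∈ closure J, HasDerivAt A (A' s) s) (hA' : ContinuousOn A' (closure J))
    (hM : ∀ s ∈ closure J, ‖A s‖ ≤ M) (hM' : ∀ s ∈ closure J, ‖A' s‖ ≤ M')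
    (hle : ∀ s ∈ closure J, μ ≤ |ψ'' s|) :
    ‖∫ s in J, Complex.exp (Complex.I * ((lam * ψ s : ℝ) : ℂ)) * A s‖
      ≤ (10 * M + 4 * M' * r) / √(|lam| * μ) := by
  rcases J.eq_empty_or_nonempty with rfl | hne
  · rw [Measure.restrict_empty, integral_zero_measure, norm_zero]
    positivity
  have hbb : BddBelow J := ⟨-r, fun x hx => (hJr hx).1⟩
  have hba : BddAbove J := ⟨r, fun x hx => (hJr hx).2⟩
  have hconn : IsConnected J := ⟨hne, hJ.isPreconnected⟩
  have hIoo : Set.Ioo (sInf J) (sSup J) ⊆ J := hconn.Ioo_csInf_csSup_subset hbb hba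
  have hIcc : J ⊆ Set.Icc (sInf J) (sSup J) := subset_Icc_csInf_csSup hbb hba
  have hab : sInf J ≤ sSup J := csInf_le_csSup hne hbb hba
  have hcl : Set.Icc (sInf J) (sSup J) ⊆ closure J := by
    intro s hs
    rcases hs.1.eq_or_lt with h | h
    · exact h ▸ csInf_mem_closure hne hbb
    rcases hs.2.eq_or_lt with h' | h'
    · exact h' ▸ csSup_mem_closure hne hba
    · exact subset_closure (hIoo ⟨h, h'⟩)
  have hae : J =ᵐ[volume] Set.Ioc (sInf J) (sSup J) := by
    refine Filter.EventuallyLE.antisymm ?_ ?_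
    · exact (LE.le.eventuallyLE hIcc).trans Ioc_ae_eq_Icc.symm.le
    · exact Ioo_ae_eq_Ioc.symm.le.trans (LE.le.eventuallyLE hIoo)
  rw [setIntegral_congr_set hae, ← intervalIntegral.integral_of_le hab]
  refine (norm_integral_exp_mul_le_of_le_abs_snd_deriv hab hlam hμ
    (fun s hs => hψ s (hcl hs)) (fun s hs => hψ' s (hcl hs)) (hψ''.mono hcl)
    (fun s hs => hA s (hcl hs)) (hA'.mono hcl) (fun s hs => hM s (hcl hs))
    (fun s hs => hM' s (hcl hs)) (fun s hs => hle s (hcl hs))).trans ?_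
  have h1 : sSup J - sInf J ≤ 2 * r := by
    have := csSup_le hne fun x hx => (hJr hx).2
    have := le_csInf hne fun x hx => (hJr hx).1
    linarith
  have : 2 * M' * (sSup J - sInf J) ≤ 4 * M' * r := by nlinarith
  gcongr

theorem integrable_indicator_inv_sqrt_abs {R : ℝ} (hR : 0 ≤ R) :
    Integrable ((Set.Icc (-R) R).indicator fun t : ℝ => 1 / √|t|) := by
  rw [integrable_indicator_iff measurableSet_Icc]
  have hp : IntervalIntegrable (fun t : ℝ => 1 / √|t|) volume 0 R := by
    refine (intervalIntegral.intervalIntegrable_rpow' (r := -(1 / 2)) (by norm_num)).congr ?_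
    intro t ht
    rw [Set.uIoc_of_le hR] at ht
    simp only
    rw [Real.rpow_neg ht.1.le, ← Real.sqrt_eq_rpow, abs_of_pos ht.1, one_div]
  have hn : IntervalIntegrable (fun t : ℝ => 1 / √|t|) volume (-R) 0 := by
    have := ((IntervalIntegrable.iff_comp_neg (by simp)).1 hp).symm
    simpa using this
  rw [integrableOn_Icc_iff_integrableOn_Ioc]
  exact (intervalIntegrable_iff_integrableOn_Ioc_of_le (by linarith)).1 (hn.trans hp)

/-- The pair (s, t) parametrises the plane by lines of direction (ω, 1), s being x₂ and t = x₁ - ωx₂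
labelling the line; the map is a shear followed by a swap. -/
theorem measurePreserving_oblique (ω : ℝ) :
    MeasurePreserving (fun q : ℝ × ℝ => (q.2 + ω * q.1, q.1)) volume volume := by
  have h1 : MeasurePreserving (fun q : ℝ × ℝ => (q.1, q.2 + ω * q.1))
      ((volume : Measure ℝ).prod volume) ((volume : Measure ℝ).prod volume) := by
    refine MeasurePreserving.skew_product (f := id) (g := fun y t => t + ω * y)
      (MeasurePreserving.id _) (by fun_prop) (ae_of_all _ fun y => ?_)
    exact (measurePreserving_add_right volume (ω * y)).map_eq
  exact Measure.measurePreserving_swap.comp h1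

/-- The second derivative of `φ` in the direction `(ω, 1)`. -/
noncomputable def obliqueHessian (ω : ℝ) (φ : ℝ × ℝ → ℝ) (p : ℝ × ℝ) : ℝ :=
  ω ^ 2 * mixedPD (2, 0) φ p + 2 * ω * mixedPD (1, 1) φ p + mixedPD (0, 2) φ p

theorem hasDerivAt_oblique {V : Set (ℝ × ℝ)} (hV : IsOpen V) {φ : ℝ × ℝ → ℝ}
    (hφ : ContDiffOn ℝ (2 : ℕ) φ V) {t ω s : ℝ} (hs : (t + ω * s, s) ∈ V) :
    HasDerivAt (fun s => ω * pd1 φ (t + ω * s, s) + pd2 φ (t + ω * s, s))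
      (obliqueHessian ω φ (t + ω * s, s)) s := by
  have hd : ∀ {k : ℝ × ℝ → ℝ}, ContDiffOn ℝ (1 : ℕ) k V → DifferentiableAt ℝ k (t + ω * s, s) :=
    fun hk => (hk.contDiffAt (hV.mem_nhds hs)).differentiableAt (by simp)
  have h1 := hasDerivAt_comp_line t ω s (hd (contDiffOn_pd1 hV le_rfl hφ))
  have h2 := hasDerivAt_comp_line t ω s (hd (contDiffOn_pd2 hV le_rfl hφ))
  refine ((h1.const_mul ω).add h2).congr_deriv ?_
  rw [pd2_pd1 hV hφ hs]
  simp only [obliqueHessian, smul_eq_mul]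
  change ω * (ω * mixedPD (2, 0) φ _ + mixedPD (1, 1) φ _) +
    (ω * mixedPD (1, 1) φ _ + mixedPD (0, 2) φ _) = _
  ring

theorem continuousOn_obliqueHessian {V : Set (ℝ × ℝ)} (hV : IsOpen V) {φ : ℝ × ℝ → ℝ}
    (hφ : ContDiffOn ℝ (2 : ℕ) φ V) (ω : ℝ) : ContinuousOn (obliqueHessian ω φ) V := by
  have h (α : ℕ × ℕ) (hα : α.1 + α.2 ≤ 2) : ContinuousOn (mixedPD α φ) V :=
    (contDiffOn_mixedPD hV α (m := 0) (by lia) hφ).continuousOn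
  have h1 := h (2, 0) (by simp)
  have h2 := h (1, 1) (by simp)
  have h3 := h (0, 2) (by simp)
  unfold obliqueHessian
  fun_prop

theorem continuousOn_exp_mul {S : Set (ℝ × ℝ)} {φ : ℝ × ℝ → ℝ} (hφ : ContinuousOn φ S)
    {a : ℝ × ℝ → ℂ} (ha : Continuous a) (lam : ℝ) :
    ContinuousOn (fun x => Complex.exp (Complex.I * ((lam * φ x : ℝ) : ℂ)) * a x) S :=
  (Complex.continuous_exp.comp_continuousOn (continuousOn_const.mul
    (Complex.continuous_ofReal.comp_continuousOn (continuousOn_const.mul hφ)))).mul ha.continuousOn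

/-- An oscillatory integral over a region whose slices in the direction `(ω, 1)` are intervals, when
the second derivative of the phase in that direction dominates the distance to a fixed slice. -/
theorem norm_oscIntegral_le_of_oblique {V D : Set (ℝ × ℝ)} (hV : IsOpen V) {r : ℝ} (hr : 0 < r)
    (hr1 : r ≤ 1) (hrV : Metric.closedBall 0 r ⊆ V) {φ : ℝ × ℝ → ℝ}
    (hφ : ContDiffOn ℝ (2 : ℕ) φ V) {ω : ℝ} (hω : |ω| ≤ 1) {m : ℝ} (hm : 0 < m)
    (hDm : MeasurableSet D) (hDr : D ⊆ Metric.closedBall 0 r)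
    (hDc : ∀ t, {s : ℝ | (t + ω * s, s) ∈ D}.OrdConnected) {t₀ : ℝ} (ht₀ : |t₀| ≤ 2)
    (hle : ∀ p ∈ closure D, m * |p.1 - ω * p.2 - t₀| ≤ |obliqueHessian ω φ p|)
    {a : ℝ × ℝ → ℂ} (ha : ContDiff ℝ 1 a) {M : ℝ}
    (hM : ∀ x, ‖a x‖ ≤ M ∧ ‖pd1 a x‖ ≤ M ∧ ‖pd2 a x‖ ≤ M) {lam : ℝ} (hlam : lam ≠ 0) :
    ‖oscIntegral D lam φ a‖ ≤ 18 * M / √(|lam| * m) *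
      ∫ t, (Set.Icc (-4) 4).indicator (fun t : ℝ => 1 / √|t|) t := by
  have hM0 : 0 ≤ M := (norm_nonneg _).trans (hM 0).1
  set G : ℝ × ℝ → ℂ := fun x => Complex.exp (Complex.I * ((lam * φ x : ℝ) : ℂ)) * a x with hG
  have hGi : Integrable (D.indicator G) := by
    rw [integrable_indicator_iff hDm]
    exact ((continuousOn_exp_mul (hφ.continuousOn.mono hrV) ha.continuous lam).integrableOn_compact
      (isCompact_closedBall _ _)).mono_set hDr
  have hmp := measurePreserving_oblique ω
  have hDb : ∀ {t s : ℝ}, (t + ω * s, s) ∈ Metric.closedBall (0 : ℝ × ℝ) r →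
      |t + ω * s| ≤ r ∧ |s| ≤ r := by
    intro t s h
    rw [mem_closedBall_zero_iff, Prod.norm_def] at h
    exact ⟨(le_max_left _ _).trans h, (le_max_right _ _).trans h⟩
  have hclD : closure D ⊆ Metric.closedBall 0 r := closure_minimal hDr Metric.isClosed_closedBall
  have hsplit : oscIntegral D lam φ a =
      ∫ t : ℝ, ∫ s in {s : ℝ | (t + ω * s, s) ∈ D}, G (t + ω * s, s) := by
    have h1 : oscIntegral D lam φ a = ∫ x, D.indicator G x := (integral_indicator hDm).symm
    have h2 : ∫ x, D.indicator G x = ∫ q : ℝ × ℝ, D.indicator G (q.2 + ω * q.1, q.1) := by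
      conv_lhs => rw [← hmp.map_eq]
      refine integral_map hmp.aemeasurable ?_
      rw [hmp.map_eq]
      exact hGi.aestronglyMeasurable
    have hGi' : Integrable (fun q : ℝ × ℝ => D.indicator G (q.2 + ω * q.1, q.1)) :=
      hmp.integrable_comp_of_integrable hGi
    rw [h1, h2, Measure.volume_eq_prod, integral_prod_symm _ hGi']
    refine integral_congr_ae (ae_of_all _ fun t => ?_)
    have hc : Measurable fun s : ℝ => (t + ω * s, s) := by fun_prop
    exact integral_indicator (f := fun s => G (t + ω * s, s)) (hc hDm)
  have hbi := ((integrable_indicator_inv_sqrt_abs (R := 4) (by norm_num)).comp_sub_right t₀).const_mul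
    (18 * M / √(|lam| * m))
  rw [hsplit, ← integral_sub_right_eq_self (fun t => (Set.Icc (-4) 4).indicator _ t) t₀,
    ← integral_const_mul]
  refine norm_integral_le_of_norm_le hbi ?_
  filter_upwards [Measure.ae_ne volume t₀] with t ht
  have hpos : 0 < |t - t₀| := abs_pos.2 (sub_ne_zero.2 ht)
  rcases Set.eq_empty_or_nonempty {s : ℝ | (t + ω * s, s) ∈ D} with he | ⟨s₀, hs₀⟩
  · rw [he, Measure.restrict_empty, integral_zero_measure, norm_zero]
    refine mul_nonneg (by positivity) (Set.indicator_nonneg (fun _ _ => by positivity) _)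
  -- A nonempty slice has |t| ≤ |t + ωs| + |ωs| ≤ 2, and |t₀| ≤ 2.
  have ht4 : t - t₀ ∈ Set.Icc (-4 : ℝ) 4 := by
    obtain ⟨h1, h2⟩ := hDb (hDr hs₀)
    have h3 : |ω * s₀| ≤ 1 := by
      rw [abs_mul]
      exact mul_le_one₀ hω (abs_nonneg _) (h2.trans hr1)
    rw [abs_le] at h1 h3 ht₀
    constructor <;> linarith [h1.1, h1.2, h3.1, h3.2, ht₀.1, ht₀.2]
  rw [Set.indicator_of_mem ht4]
  have hc : Continuous fun s : ℝ => (t + ω * s, s) := by fun_prop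
  have hcl : ∀ s ∈ closure {s : ℝ | (t + ω * s, s) ∈ D}, (t + ω * s, s) ∈ closure D := by
    intro s hs
    exact map_mem_closure (f := fun s : ℝ => (t + ω * s, s)) hc hs fun x hx => hx
  have hclV : ∀ s ∈ closure {s : ℝ | (t + ω * s, s) ∈ D}, (t + ω * s, s) ∈ V :=
    fun s hs => hrV (hclD (hcl s hs))
  have ha1 : ContDiffOn ℝ (1 : ℕ) a Set.univ := by exact_mod_cast ha.contDiffOn
  have hpa1 : Continuous (pd1 a) :=
    continuousOn_univ.1 (contDiffOn_pd1 isOpen_univ (m := 0) le_rfl ha1).continuousOn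
  have hpa2 : Continuous (pd2 a) :=
    continuousOn_univ.1 (contDiffOn_pd2 isOpen_univ (m := 0) le_rfl ha1).continuousOn
  -- The amplitude derivative along the slice is at most (|ω| + 1)M ≤ 2M, so 10M + 4M'r ≤ 18M
  -- because r ≤ 1.
  have hv := norm_setIntegral_exp_mul_le (hDc t) (r := r) (lam := lam) (μ := m * |t - t₀|)
    (M := M) (M' := 2 * M) (ψ := fun s => φ (t + ω * s, s))
    (ψ' := fun s => ω * pd1 φ (t + ω * s, s) + pd2 φ (t + ω * s, s))
    (ψ'' := fun s => obliqueHessian ω φ (t + ω * s, s))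
    (A := fun s => a (t + ω * s, s))
    (A' := fun s => ω • pd1 a (t + ω * s, s) + pd2 a (t + ω * s, s))
    (fun s hs => abs_le.1 (hDb (hDr hs)).2) hr.le hlam (mul_pos hm hpos) hM0 (by positivity)
    (fun s hs => hasDerivAt_comp_line t ω s
      ((hφ.contDiffAt (hV.mem_nhds (hclV s hs))).differentiableAt (by simp)))
    (fun s hs => hasDerivAt_oblique hV hφ (hclV s hs))
    ((continuousOn_obliqueHessian hV hφ ω).comp hc.continuousOn hclV)
    (fun s _ => hasDerivAt_comp_line t ω s (ha.differentiable (by simp)).differentiableAt)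
    (((hpa1.comp hc).const_smul ω).add (hpa2.comp hc)).continuousOn
    (fun s _ => (hM _).1) ?_ ?_
  · refine hv.trans ?_
    rw [← mul_assoc |lam|, Real.sqrt_mul (by positivity) |t - t₀|, div_mul_div_comm, mul_one]
    gcongr
    nlinarith
  · intro s _
    refine (norm_add_le _ _).trans ?_
    rw [norm_smul, Real.norm_eq_abs, two_mul]
    refine add_le_add ?_ (hM _).2.2
    calc |ω| * ‖pd1 a (t + ω * s, s)‖ ≤ 1 * M := by
          gcongr
          exact (hM _).2.1
      _ = M := one_mul M
  · intro s hs
    have := hle _ (hcl s hs)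
    simpa using this

/-! ### The centre of the perturbed phase and the three regions around it -/

/-- For the model, φ₂₂ = 2x₁ and φ₁₂ = 2x₂, so the two equations say that both derivatives of the
full phase vanish at p. They are a fixed point equation for -(h₂₂, h₁₂)/2, which maps the square
into itself and, by the bound on third derivatives, is a contraction. -/
theorem exists_mixedPD_eq_center {V : Set (ℝ × ℝ)} (hV : IsOpen V) {r : ℝ} (hr : 0 < r)
    (hrV : Metric.closedBall 0 r ⊆ V) {h : ℝ × ℝ → ℝ} (hh : ContDiffOn ℝ (3 : ℕ) h V)
    (h2 : ∀ β : ℕ × ℕ, β.1 + β.2 = 2 → ∀ x ∈ Metric.closedBall (0 : ℝ × ℝ) r, ‖mixedPD β h x‖ ≤ r)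
    (h3 : ∀ β : ℕ × ℕ, β.1 + β.2 = 3 → ∀ x ∈ Metric.closedBall (0 : ℝ × ℝ) r,
      ‖mixedPD β h x‖ ≤ 1 / 8) :
    ∃ p ∈ Metric.closedBall (0 : ℝ × ℝ) r,
      mixedPD (0, 2) h p = -2 * p.1 ∧ mixedPD (1, 1) h p = -2 * p.2 := by
  set Θ : ℝ × ℝ → ℝ × ℝ := fun p => (-mixedPD (0, 2) h p / 2, -mixedPD (1, 1) h p / 2) with hΘ
  have hmaps : Set.MapsTo Θ (Metric.closedBall 0 r) (Metric.closedBall 0 r) := by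
    intro p hp
    have e1 := h2 (0, 2) rfl p hp
    have e2 := h2 (1, 1) rfl p hp
    rw [Real.norm_eq_abs] at e1 e2
    rw [mem_closedBall_zero_iff, Prod.norm_def, max_le_iff]
    simp only [hΘ, norm_div, norm_neg, Real.norm_eq_abs, abs_two]
    constructor <;> linarith
  have hcontr : ContractingWith (1 / 2) (hmaps.restrict Θ _ _) := by
    refine ⟨by norm_num [← NNReal.coe_lt_coe], LipschitzWith.of_dist_le_mul ?_⟩
    rintro ⟨p, hp⟩ ⟨q, hq⟩
    change dist (Θ p) (Θ q) ≤ _ * dist p q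
    have e1 := norm_mixedPD_sub_le hV (convex_closedBall _ _) hrV (0, 2) (n := 3) (by simp) hh
      (fun β hβ => h3 β hβ) hp hq
    have e2 := norm_mixedPD_sub_le hV (convex_closedBall _ _) hrV (1, 1) (n := 3) (by simp) hh
      (fun β hβ => h3 β hβ) hp hq
    rw [Real.norm_eq_abs, abs_le] at e1 e2
    have := norm_nonneg (p - q)
    rw [dist_eq_norm, dist_eq_norm, Prod.norm_def, max_le_iff]
    simp only [hΘ, Real.norm_eq_abs, abs_le, Prod.mk_sub_mk]
    push_cast
    refine ⟨⟨?_, ?_⟩, ?_, ?_⟩ <;> linarith [e1.1, e1.2, e2.1, e2.2]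
  obtain ⟨p, hp, hfix, -⟩ := hcontr.exists_fixedPoint' Metric.isClosed_closedBall.isComplete hmaps
    (Metric.mem_closedBall_self hr.le) (edist_ne_top _ _)
  have e1 := congrArg Prod.fst hfix
  have e2 := congrArg Prod.snd hfix
  simp only [hΘ] at e1 e2
  exact ⟨p, hp, by linarith, by linarith⟩

/-- The oscillatory integral with phase a perturbation of `x₁ x₂²` that is small in `C³`. -/
theorem norm_oscIntegral_le_of_perturbation {V : Set (ℝ × ℝ)} (hV : IsOpen V) {r : ℝ} (hr : 0 < r)
    (hr1 : r ≤ 1) (hrV : Metric.closedBall 0 r ⊆ V) {h φ : ℝ × ℝ → ℝ}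
    (hh : ContDiffOn ℝ (3 : ℕ) h V)
    (hφ : Set.EqOn φ ((fun x : ℝ × ℝ => x.1 * x.2 ^ 2) + h) V)
    (h2 : ∀ β : ℕ × ℕ, β.1 + β.2 = 2 → ∀ x ∈ Metric.closedBall (0 : ℝ × ℝ) r, ‖mixedPD β h x‖ ≤ r)
    (h3 : ∀ β : ℕ × ℕ, β.1 + β.2 = 3 → ∀ x ∈ Metric.closedBall (0 : ℝ × ℝ) r,
      ‖mixedPD β h x‖ ≤ 1 / 8)
    {a : ℝ × ℝ → ℂ} (ha : ContDiff ℝ 1 a) {M : ℝ}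
    (hM : ∀ x, ‖a x‖ ≤ M ∧ ‖pd1 a x‖ ≤ M ∧ ‖pd2 a x‖ ≤ M) {lam : ℝ} (hlam : lam ≠ 0) :
    ‖oscIntegral (Metric.ball 0 r) lam φ a‖ ≤ 3 * (18 * M / √(|lam| * (1 / 2)) *
      ∫ t, (Set.Icc (-4) 4).indicator (fun t : ℝ => 1 / √|t|) t) := by
  have hmodel : ContDiff ℝ (3 : ℕ) (fun x : ℝ × ℝ => x.1 * x.2 ^ 2) := by fun_prop
  have hφc : ContDiffOn ℝ (3 : ℕ) φ V := (hmodel.contDiffOn.add hh).congr hφ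
  have hφ2 : ContDiffOn ℝ (2 : ℕ) φ V := hφc.of_le (by norm_cast)
  obtain ⟨p₀, hp₀, hc02, hc11⟩ := exists_mixedPD_eq_center hV hr hrV hh h2 h3
  set κ := mixedPD (2, 0) h p₀ with hκ
  have hx₀ : |p₀.1| ≤ 1 ∧ |p₀.2| ≤ 1 := by
    rw [mem_closedBall_zero_iff, Prod.norm_def, max_le_iff] at hp₀
    exact ⟨hp₀.1.trans hr1, hp₀.2.trans hr1⟩
  have hder : ∀ α : ℕ × ℕ, α.1 + α.2 = 2 → ∀ p ∈ Metric.closedBall (0 : ℝ × ℝ) r,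
      mixedPD α φ p = mixedPD α (fun x : ℝ × ℝ => x.1 * x.2 ^ 2) p + mixedPD α h p := by
    intro α hα p hp
    rw [eqOn_mixedPD hV α hφ (hrV hp),
      mixedPD_add hV α (n := 3) (by lia) hmodel.contDiffOn hh (hrV hp)]
    rfl
  -- Expansion of the Hessian about the centre. The errors come from the mean value inequality with
  -- δ = 1/8; κ is kept exact, since only its sign will matter.
  have hhess : ∀ p ∈ Metric.closedBall (0 : ℝ × ℝ) r, ∃ e20 e11 e02 : ℝ,
      |e20| ≤ max |p.1 - p₀.1| |p.2 - p₀.2| / 4 ∧ |e11| ≤ max |p.1 - p₀.1| |p.2 - p₀.2| / 4 ∧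
      |e02| ≤ max |p.1 - p₀.1| |p.2 - p₀.2| / 4 ∧
      ∀ ω : ℝ, obliqueHessian ω φ p = ω ^ 2 * (κ + e20) + 2 * ω * (2 * (p.2 - p₀.2) + e11) +
        (2 * (p.1 - p₀.1) + e02) := by
    intro p hp
    have hbound : ∀ α : ℕ × ℕ, α.1 + α.2 = 2 →
        |mixedPD α h p - mixedPD α h p₀| ≤ max |p.1 - p₀.1| |p.2 - p₀.2| / 4 := by
      intro α hα
      have := norm_mixedPD_sub_le hV (convex_closedBall _ _) hrV α (n := 3) (by lia) hh
        (fun β hβ => h3 β (by lia)) hp hp₀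
      rw [Real.norm_eq_abs, Prod.norm_def] at this
      refine this.trans_eq ?_
      simp only [Prod.fst_sub, Prod.snd_sub, Real.norm_eq_abs]
      ring
    refine ⟨_, _, _, hbound (2, 0) rfl, hbound (1, 1) rfl, hbound (0, 2) rfl, fun ω => ?_⟩
    simp only [obliqueHessian]
    rw [hder _ rfl p hp, hder _ rfl p hp, hder _ rfl p hp, mixedPD_two_zero_model,
      mixedPD_one_one_model, mixedPD_zero_two_model, hc02, hc11]
    simp only [Pi.zero_apply]
    ring
  -- `A` is a double cone, not convex, but its vertical slices are intervals; `B 1` and `B (-1)` are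
  -- the two convex cones left over.
  set A : Set (ℝ × ℝ) := {p | |p.2 - p₀.2| ≤ |p.1 - p₀.1|} with hA
  set B : ℝ → Set (ℝ × ℝ) := fun τ => {p | |p.1 - p₀.1| < τ * (p.2 - p₀.2)} with hB
  have hAcl : IsClosed A := isClosed_le (by fun_prop) (by fun_prop)
  have hBo : ∀ τ, IsOpen (B τ) := fun τ => isOpen_lt (by fun_prop) (by fun_prop)
  have hAint : ‖oscIntegral (Metric.ball 0 r ∩ A) lam φ a‖ ≤ 18 * M / √(|lam| * (1 / 2)) *
      ∫ t, (Set.Icc (-4) 4).indicator (fun t : ℝ => 1 / √|t|) t := by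
    refine norm_oscIntegral_le_of_oblique hV hr hr1 hrV hφ2 (ω := 0) (by simp) (by norm_num)
      (measurableSet_ball.inter hAcl.measurableSet)
      (Set.inter_subset_left.trans Metric.ball_subset_closedBall) ?_ (t₀ := p₀.1)
      (hx₀.1.trans (by norm_num)) ?_ ha hM hlam
    · refine fun t => ⟨fun x hx y hy z hz => ?_⟩
      simp only [hA, Set.mem_ofPred_eq, Set.mem_inter_iff, mem_ball_zero_iff, Prod.norm_def,
        max_lt_iff, Real.norm_eq_abs, zero_mul, add_zero] at hx hy ⊢
      refine ⟨⟨hx.1.1, ?_⟩, ?_⟩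
      · have h1 := abs_lt.1 hx.1.2
        have h2 := abs_lt.1 hy.1.2
        exact abs_lt.2 ⟨by linarith [hz.1], by linarith [hz.2]⟩
      · have h1 := abs_le.1 hx.2
        have h2 := abs_le.1 hy.2
        exact abs_le.2 ⟨by linarith [hz.1], by linarith [hz.2]⟩
    · intro p hp
      have hp' : p ∈ Metric.closedBall 0 r ∩ A := closure_minimal
        (Set.inter_subset_inter_left _ Metric.ball_subset_closedBall)
        (Metric.isClosed_closedBall.inter hAcl) hp
      obtain ⟨e20, e11, e02, -, -, h02, hq⟩ := hhess p hp'.1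
      rw [hq, max_eq_left hp'.2] at *
      have e : (0 : ℝ) ^ 2 * (κ + e20) + 2 * 0 * (2 * (p.2 - p₀.2) + e11) +
        (2 * (p.1 - p₀.1) + e02) = 2 * (p.1 - p₀.1) + e02 := by ring
      rw [e, zero_mul, sub_zero]
      have := abs_sub_abs_le_abs_add (2 * (p.1 - p₀.1)) e02
      rw [abs_mul, abs_two] at this
      linarith [abs_nonneg (p.1 - p₀.1)]
  have hBint : ∀ τ : ℝ, τ = 1 ∨ τ = -1 →
      ‖oscIntegral (Metric.ball 0 r ∩ B τ) lam φ a‖ ≤ 18 * M / √(|lam| * (1 / 2)) *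
        ∫ t, (Set.Icc (-4) 4).indicator (fun t : ℝ => 1 / √|t|) t := by
    intro τ hτ
    -- With ω = τσ, the number σ times the oblique second derivative contains |κ| + 4τY, so the
    -- unknown κ can only help.
    obtain ⟨σ, hσ, hσκ⟩ : ∃ σ : ℝ, (σ = 1 ∨ σ = -1) ∧ 0 ≤ σ * κ := by
      rcases le_total 0 κ with h | h
      · exact ⟨1, Or.inl rfl, by simpa using h⟩
      · exact ⟨-1, Or.inr rfl, by simpa using h⟩
    have habs : |τ * σ| = 1 := by rcases hτ with rfl | rfl <;> rcases hσ with rfl | rfl <;> simp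
    refine norm_oscIntegral_le_of_oblique hV hr hr1 hrV hφ2 (ω := τ * σ) habs.le (by norm_num)
      (measurableSet_ball.inter (hBo τ).measurableSet)
      (Set.inter_subset_left.trans Metric.ball_subset_closedBall) ?_
      (t₀ := p₀.1 - τ * σ * p₀.2) ?_ ?_ ha hM hlam
    · refine fun t => ⟨fun x hx y hy z hz => ?_⟩
      simp only [hB, Set.mem_ofPred_eq, Set.mem_inter_iff, mem_ball_zero_iff, Prod.norm_def,
        max_lt_iff, Real.norm_eq_abs, abs_lt] at hx hy ⊢
      obtain ⟨⟨⟨a1, a2⟩, a3, a4⟩, a5, a6⟩ := hx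
      obtain ⟨⟨⟨b1, b2⟩, b3, b4⟩, b5, b6⟩ := hy
      obtain ⟨z1, z2⟩ := hz
      rcases hτ with rfl | rfl <;> rcases hσ with rfl | rfl <;>
        refine ⟨⟨⟨?_, ?_⟩, ?_, ?_⟩, ?_, ?_⟩ <;> linarith
    · refine (abs_sub _ _).trans ?_
      rw [abs_mul, habs]
      linarith [hx₀.1, hx₀.2]
    · intro p hp
      have hcl : IsClosed {p : ℝ × ℝ | |p.1 - p₀.1| ≤ τ * (p.2 - p₀.2)} :=
        isClosed_le (by fun_prop) (by fun_prop)
      have hsub : B τ ⊆ {p | |p.1 - p₀.1| ≤ τ * (p.2 - p₀.2)} :=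
        Set.ofPred_subset_ofPred.2 fun q hq => le_of_lt hq
      have hp' : p ∈ Metric.closedBall 0 r ∩ {p | |p.1 - p₀.1| ≤ τ * (p.2 - p₀.2)} :=
        closure_minimal (Set.inter_subset_inter Metric.ball_subset_closedBall hsub)
          (Metric.isClosed_closedBall.inter hcl) hp
      obtain ⟨e20, e11, e02, h20, h11, h02, hq⟩ := hhess p hp'.1
      have hXY : |p.1 - p₀.1| ≤ τ * (p.2 - p₀.2) := hp'.2
      have hY : |p.2 - p₀.2| = τ * (p.2 - p₀.2) := by
        have h0 := (abs_nonneg _).trans hXY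
        rw [← abs_of_nonneg h0, abs_mul]
        rcases hτ with rfl | rfl <;> simp
      rw [hq]
      rw [hY, max_eq_right hXY] at h20 h11 h02
      have hl : |p.1 - τ * σ * p.2 - (p₀.1 - τ * σ * p₀.2)| ≤ 2 * (τ * (p.2 - p₀.2)) := by
        have e : p.1 - τ * σ * p.2 - (p₀.1 - τ * σ * p₀.2) =
          (p.1 - p₀.1) - (τ * σ) * (p.2 - p₀.2) := by ring
        rw [e]
        refine (abs_sub _ _).trans ?_
        rw [abs_mul, habs, one_mul, hY]
        linarith
      rw [abs_le] at hXY h20 h11 h02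
      obtain ⟨x1, x2⟩ := hXY
      obtain ⟨u1, u2⟩ := h20
      obtain ⟨v1, v2⟩ := h11
      obtain ⟨w1, w2⟩ := h02
      -- The slice distance |X - ωY| is at most 2|Y|, which gives m = 1/2. The second derivative is
      -- at least 4|Y| - 2|X| - (1/4 + 1/2 + 1/4)|Y| ≥ |Y|.
      refine (by linarith : _ ≤ τ * (p.2 - p₀.2)).trans ?_
      rcases hσ with rfl | rfl
      · refine le_trans ?_ (le_abs_self _)
        rcases hτ with rfl | rfl <;> linarith
      · refine le_trans ?_ (neg_le_abs _)
        rcases hτ with rfl | rfl <;> linarith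
  have hGi : IntegrableOn (fun x => Complex.exp (Complex.I * ((lam * φ x : ℝ) : ℂ)) * a x)
      (Metric.ball 0 r) :=
    ((continuousOn_exp_mul (hφc.continuousOn.mono hrV) ha.continuous lam).integrableOn_compact
      (isCompact_closedBall _ _)).mono_set Metric.ball_subset_closedBall
  have hdiff : Metric.ball 0 r \ A = (Metric.ball 0 r ∩ B 1) ∪ (Metric.ball 0 r ∩ B (-1)) := by
    ext p
    simp only [hA, hB, Set.mem_sdiff, Set.mem_union, Set.mem_inter_iff, Set.mem_ofPred_eq, not_le,
      one_mul, neg_one_mul, lt_abs, ← and_or_left]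
  have hdisj : Disjoint (Metric.ball 0 r ∩ B 1) (Metric.ball 0 r ∩ B (-1)) := by
    rw [Set.disjoint_left]
    rintro p ⟨-, h1⟩ ⟨-, h2⟩
    simp only [hB, Set.mem_ofPred_eq] at h1 h2
    linarith [abs_nonneg (p.1 - p₀.1)]
  have hsplit : oscIntegral (Metric.ball 0 r) lam φ a = oscIntegral (Metric.ball 0 r ∩ A) lam φ a +
      (oscIntegral (Metric.ball 0 r ∩ B 1) lam φ a +
        oscIntegral (Metric.ball 0 r ∩ B (-1)) lam φ a) := by
    unfold oscIntegral
    rw [← setIntegral_union hdisj (measurableSet_ball.inter (hBo _).measurableSet)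
      (hGi.mono_set Set.inter_subset_left) (hGi.mono_set Set.inter_subset_left), ← hdiff,
      integral_inter_add_sdiff hAcl.measurableSet hGi]
  rw [hsplit]
  have n1 := norm_add_le (oscIntegral (Metric.ball 0 r ∩ A) lam φ a)
    (oscIntegral (Metric.ball 0 r ∩ B 1) lam φ a + oscIntegral (Metric.ball 0 r ∩ B (-1)) lam φ a)
  have n2 := norm_add_le (oscIntegral (Metric.ball 0 r ∩ B 1) lam φ a)
    (oscIntegral (Metric.ball 0 r ∩ B (-1)) lam φ a)
  linarith [hBint 1 (Or.inl rfl), hBint (-1) (Or.inr rfl)]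

/-! ### The uniform upper bound -/

/-- A function whose derivatives up to order three vanish at the origin is small in `C³` on small
squares. -/
theorem exists_radius_of_mixedPD_eq_zero {V : Set (ℝ × ℝ)} (hV : IsOpen V) (hV0 : (0, 0) ∈ V)
    {g : ℝ × ℝ → ℝ} (hg : ContDiffOn ℝ (8 : ℕ) g V)
    (hg0 : ∀ α : ℕ × ℕ, α.1 + α.2 ≤ 3 → mixedPD α g (0, 0) = 0) :
    ∃ r : ℝ, 0 < r ∧ r ≤ 1 ∧ Metric.closedBall 0 r ⊆ V ∧
      (∀ β : ℕ × ℕ, β.1 + β.2 = 3 → ∀ x ∈ Metric.closedBall (0 : ℝ × ℝ) r,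
        ‖mixedPD β g x‖ ≤ 1 / 16) ∧
      ∀ β : ℕ × ℕ, β.1 + β.2 = 2 → ∀ x ∈ Metric.closedBall (0 : ℝ × ℝ) r,
        ‖mixedPD β g x‖ ≤ r / 8 := by
  have hev : ∀ᶠ x in nhds (0 : ℝ × ℝ), x ∈ V ∧
      ∀ β ∈ Finset.HasAntidiagonal.antidiagonal 3, ‖mixedPD β g x‖ ≤ 1 / 16 := by
    have hVe : ∀ᶠ x in nhds (0 : ℝ × ℝ), x ∈ V := hV.mem_nhds hV0
    refine hVe.and ?_
    rw [Filter.eventually_all_finset]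
    intro β hβ
    rw [Finset.HasAntidiagonal.mem_antidiagonal] at hβ
    have hc : ContinuousAt (fun x => ‖mixedPD β g x‖) 0 :=
      ((contDiffOn_mixedPD hV β (m := 0) (by lia) hg).continuousOn.continuousAt
        (hV.mem_nhds hV0)).norm
    refine (hc.eventually_lt continuousAt_const ?_).mono fun x hx => hx.le
    have := hg0 β hβ.le
    rw [Prod.mk_zero_zero] at this
    rw [this, norm_zero]
    norm_num
  obtain ⟨ρ, hρ, hball⟩ := Metric.nhds_basis_closedBall.eventually_iff.1 hev
  have hsub : Metric.closedBall (0 : ℝ × ℝ) (min ρ 1) ⊆ Metric.closedBall 0 ρ :=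
    Metric.closedBall_subset_closedBall (min_le_left _ _)
  have hr : 0 < min ρ 1 := lt_min hρ one_pos
  have hV' : Metric.closedBall (0 : ℝ × ℝ) (min ρ 1) ⊆ V := fun x hx => (hball (hsub hx)).1
  have h3 : ∀ β : ℕ × ℕ, β.1 + β.2 = 3 → ∀ x ∈ Metric.closedBall (0 : ℝ × ℝ) (min ρ 1),
      ‖mixedPD β g x‖ ≤ 1 / 16 := fun β hβ x hx =>
    (hball (hsub hx)).2 β (Finset.HasAntidiagonal.mem_antidiagonal.2 hβ)
  refine ⟨min ρ 1, hr, min_le_right _ _, hV', h3, fun β hβ x hx => ?_⟩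
  have := norm_mixedPD_sub_le hV (convex_closedBall _ _) hV' β (n := 8) (by lia) hg
    (fun γ hγ => h3 γ (by lia)) hx (Metric.mem_closedBall_self hr.le)
  have h0 := hg0 β (by lia)
  rw [Prod.mk_zero_zero] at h0
  rw [h0, sub_zero, sub_zero] at this
  rw [mem_closedBall_zero_iff] at hx
  linarith

theorem exists_uniform_bound {V : Set (ℝ × ℝ)} (hVo : IsOpen V) (hVb : Bornology.IsBounded V)
    (hV0 : (0, 0) ∈ V) {f g : ℝ × ℝ → ℝ} (hg : ContDiffOn ℝ 8 g V)
    (hg0 : ∀ α : ℕ × ℕ, α.1 + α.2 ≤ 3 → mixedPD α g (0, 0) = 0)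
    (hfg : ∀ x ∈ V, f x = x.1 * x.2 ^ 2 + g x) :
    ∃ ε C : ℝ, 0 < ε ∧ 0 < C ∧
      ∃ U : Set (ℝ × ℝ), IsOpen U ∧ (0, 0) ∈ U ∧ U ⊆ V ∧
        ∀ a : ℝ × ℝ → ℂ, IsC1Compact U a →
          ∀ F : ℝ × ℝ → ℝ, IsCkUpToBoundary 8 V F → ckNorm 8 V F < ε →
            ∀ lam : ℝ, lam ≠ 0 →
              ‖oscIntegral U lam (fun x => f x + F x) a‖
                ≤ C * ckNorm 1 U a / |lam| ^ (1 / 2 : ℝ) := by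
  have hg8 : ContDiffOn ℝ (8 : ℕ) g V := by exact_mod_cast hg
  obtain ⟨r, hr, hr1, hrV, h3, h2⟩ := exists_radius_of_mixedPD_eq_zero hVo hV0 hg8 hg0
  set K := ∫ t, (Set.Icc (-4) 4).indicator (fun t : ℝ => 1 / √|t|) t with hK
  have hK0 : 0 ≤ K :=
    integral_nonneg fun t => Set.indicator_nonneg (fun _ _ => by positivity) _
  -- With ε = r/16 the second derivatives of g + F stay below r/8 + r/16 ≤ r and the third below
  -- 1/16 + r/16 ≤ 1/8. The 54 is three regions times 18; the added 1 makes C positive without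
  -- showing `K` positive.
  refine ⟨r / 16, 54 / √(1 / 2) * K + 1, by positivity, by positivity, Metric.ball 0 r,
    Metric.isOpen_ball, Metric.mem_ball_self hr, Metric.ball_subset_closedBall.trans hrV, ?_⟩
  intro a ha F hF hFε lam hlam
  have hFle : ∀ β : ℕ × ℕ, β.1 + β.2 ≤ 8 → ∀ x ∈ Metric.closedBall (0 : ℝ × ℝ) r,
      ‖mixedPD β F x‖ ≤ r / 16 := fun β hβ x hx =>
    (norm_mixedPD_le_ckNorm hVb hF hβ (hrV hx)).trans hFε.le
  have hF8 : ContDiffOn ℝ (8 : ℕ) F V := hF.2.1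
  have hadd : ∀ β : ℕ × ℕ, β.1 + β.2 ≤ 8 → ∀ x ∈ Metric.closedBall (0 : ℝ × ℝ) r,
      ‖mixedPD β (g + F) x‖ ≤ ‖mixedPD β g x‖ + ‖mixedPD β F x‖ := by
    intro β hβ x hx
    rw [mixedPD_add hVo β hβ hg8 hF8 (hrV hx)]
    exact norm_add_le _ _
  have hM := fun x => ha.norm_le Metric.isBounded_ball x ⟨0, Metric.mem_ball_self hr⟩
  have hM0 : 0 ≤ ckNorm 1 (Metric.ball 0 r) a := (norm_nonneg _).trans (hM 0).1
  have hmain := norm_oscIntegral_le_of_perturbation hVo hr hr1 hrV (h := g + F)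
    (φ := fun x => f x + F x) ((hg8.add hF8).of_le (by norm_cast))
    (fun x hx => by simp only [hfg x hx, Pi.add_apply, add_assoc])
    (fun β hβ x hx => by linarith [hadd β (by lia) x hx, h2 β hβ x hx, hFle β (by lia) x hx])
    (fun β hβ x hx => by linarith [hadd β (by lia) x hx, h3 β hβ x hx, hFle β (by lia) x hx])
    ha.1 hM hlam
  refine hmain.trans ?_
  rw [← Real.sqrt_eq_rpow, Real.sqrt_mul (abs_nonneg _)]
  have hl : 0 < √|lam| := Real.sqrt_pos.2 (abs_pos.2 hlam)
  have e : 3 * (18 * ckNorm 1 (Metric.ball 0 r) a / (√|lam| * √(1 / 2)) * K) =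
      54 / √(1 / 2) * K * ckNorm 1 (Metric.ball 0 r) a / √|lam| := by
    field_simp
    ring
  rw [e]
  gcongr
  linarith

/-! ### Sharpness for the model phase -/

/-- The self-convolution of a bump function. -/
noncomputable def bumpConv (b : ContDiffBump (0 : ℝ)) : ℝ → ℝ :=
  convolution (b : ℝ → ℝ) (b : ℝ → ℝ) (ContinuousLinearMap.mul ℝ ℝ) volume

theorem bumpConv_apply (b : ContDiffBump (0 : ℝ)) (x : ℝ) :
    bumpConv b x = ∫ t, b t * b (x - t) := rfl

theorem contDiff_bumpConv (b : ContDiffBump (0 : ℝ)) : ContDiff ℝ 1 (bumpConv b) :=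
  b.hasCompactSupport.contDiff_convolution_right _ b.continuous.locallyIntegrable b.contDiff

theorem bumpConv_eq_zero (b : ContDiffBump (0 : ℝ)) {x : ℝ} (hx : 2 * b.rOut ≤ |x|) :
    bumpConv b x = 0 := by
  rw [bumpConv_apply]
  refine integral_eq_zero_of_ae (ae_of_all _ fun t => ?_)
  rcases le_or_gt b.rOut |t| with h | h
  · have := b.zero_of_le_dist (x := t) (by rwa [Real.dist_eq, sub_zero])
    simp [this]
  · have := b.zero_of_le_dist (x := x - t) (by
      rw [Real.dist_eq, sub_zero]
      linarith [abs_sub_abs_le_abs_sub x t])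
    simp [this]

/-- b is even, so the reflection x ↦ -x shows that the integral equals its own conjugate. -/
theorem integral_exp_mul_bump (b : ContDiffBump (0 : ℝ)) (w : ℝ) :
    ∫ x : ℝ, Complex.exp (Complex.I * ((w * x : ℝ) : ℂ)) * (b x : ℂ) =
      ((∫ x : ℝ, Real.cos (w * x) * b x : ℝ) : ℂ) := by
  set e : ℝ → ℂ := fun x => Complex.exp (Complex.I * ((w * x : ℝ) : ℂ)) * (b x : ℂ) with he
  have hec : Continuous e := by
    have := b.continuous
    fun_prop
  have hei : Integrable e := by
    refine hec.integrable_of_hasCompactSupport (HasCompactSupport.mul_left ?_)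
    exact b.hasCompactSupport.comp_left (g := fun y : ℝ => (y : ℂ)) Complex.ofReal_zero
  have hconj : (starRingEnd ℂ) (∫ x, e x) = ∫ x, e x := by
    rw [← integral_conj, ← integral_neg_eq_self]
    refine integral_congr_ae (ae_of_all _ fun x => ?_)
    simp only [he, map_mul, Complex.conj_ofReal, ← Complex.exp_conj, Complex.conj_I, b.neg]
    congr 2
    push_cast
    ring
  rw [← Complex.conj_eq_iff_re.1 hconj]
  congr 1
  have := Complex.reCLM.integral_comp_comm hei
  simp only [Complex.reCLM_apply] at this
  rw [← this]
  refine integral_congr_ae (ae_of_all _ fun x => ?_)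
  simp only [he]
  rw [Complex.re_mul_ofReal, mul_comm Complex.I, Complex.exp_ofReal_mul_I_re]

/-- The Fourier transform takes convolution to product. The result is the square of a real number,
and this nonnegativity is the reason for using b∗b in place of b. -/
theorem integral_exp_mul_bumpConv (b : ContDiffBump (0 : ℝ)) (w : ℝ) :
    ∫ x : ℝ, Complex.exp (Complex.I * ((w * x : ℝ) : ℂ)) * (bumpConv b x : ℂ) =
      (((∫ x : ℝ, Real.cos (w * x) * b x) ^ 2 : ℝ) : ℂ) := by
  set e : ℝ → ℂ := fun x => Complex.exp (Complex.I * ((w * x : ℝ) : ℂ)) * (b x : ℂ) with he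
  have hec : Continuous e := by
    have := b.continuous
    fun_prop
  have hei : Integrable e := by
    refine hec.integrable_of_hasCompactSupport (HasCompactSupport.mul_left ?_)
    exact b.hasCompactSupport.comp_left (g := fun y : ℝ => (y : ℂ)) Complex.ofReal_zero
  have hconv := integral_convolution (ContinuousLinearMap.mul ℝ ℂ) hei hei
  rw [ContinuousLinearMap.mul_apply', integral_exp_mul_bump, ← Complex.ofReal_mul, ← sq] at hconv
  rw [← hconv]
  refine integral_congr_ae (ae_of_all _ fun x => ?_)
  simp only [convolution_def, ContinuousLinearMap.mul_apply', bumpConv_apply]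
  rw [← integral_complex_ofReal, ← integral_const_mul]
  refine integral_congr_ae (ae_of_all _ fun t => ?_)
  have h : Complex.exp (Complex.I * ((w * x : ℝ) : ℂ)) =
      Complex.exp (Complex.I * ((w * t : ℝ) : ℂ)) *
        Complex.exp (Complex.I * ((w * (x - t) : ℝ) : ℂ)) := by
    rw [← Complex.exp_add]
    congr 1
    push_cast
    ring
  simp only [he]
  rw [h]
  push_cast
  ring

/-- On the support of b one has |wx| ≤ 1, where cos(wx) ≥ 1 - (wx)²/2 ≥ 1/2. -/
theorem half_integral_bump_le (b : ContDiffBump (0 : ℝ)) (hb : b.rOut ≤ 1) {w : ℝ} (hw : |w| ≤ 1) :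
    (∫ x, b x) / 2 ≤ ∫ x : ℝ, Real.cos (w * x) * b x := by
  have hbi : Integrable (b : ℝ → ℝ) := b.continuous.integrable_of_hasCompactSupport
    b.hasCompactSupport
  have hci : Integrable fun x : ℝ => Real.cos (w * x) * b x := by
    refine Continuous.integrable_of_hasCompactSupport ?_ b.hasCompactSupport.mul_left
    have := b.continuous
    fun_prop
  rw [← integral_div]
  refine integral_mono (hbi.div_const 2) hci fun x => ?_
  simp only
  rcases le_or_gt b.rOut |x| with h | h
  · have := b.zero_of_le_dist (x := x) (by rwa [Real.dist_eq, sub_zero])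
    simp [this]
  · have h1 : |w * x| ≤ 1 := by
      rw [abs_mul]
      exact mul_le_one₀ hw (abs_nonneg _) (h.le.trans hb)
    have h2 : (w * x) ^ 2 ≤ 1 := (sq_le_one_iff_abs_le_one _).2 h1
    have h3 := Real.one_sub_sq_div_two_le_cos (x := w * x)
    have := b.nonneg (x := x)
    nlinarith

theorem exists_sharp_amplitude {U : Set (ℝ × ℝ)} (hU : IsOpen U) (hU0 : (0, 0) ∈ U) {f : ℝ × ℝ → ℝ}
    (hf : ∀ x ∈ U, f x = x.1 * x.2 ^ 2) :
    ∃ a : ℝ × ℝ → ℂ, IsC1Compact U a ∧ ∃ c L : ℝ, 0 < c ∧ 0 < L ∧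
      ∀ lam : ℝ, L ≤ |lam| → c / |lam| ^ (1 / 2 : ℝ) ≤ ‖oscIntegral U lam f a‖ := by
  obtain ⟨ρ', hρ', hball⟩ := Metric.nhds_basis_closedBall.mem_iff.1 (hU.mem_nhds hU0)
  set ρ := min ρ' 1 with hρ
  have hρ0 : 0 < ρ := lt_min hρ' one_pos
  have hρ1 : ρ ≤ 1 := min_le_right _ _
  have hρU : Metric.closedBall (0 : ℝ × ℝ) ρ ⊆ U :=
    (Metric.closedBall_subset_closedBall (min_le_left _ _)).trans hball
  -- The outer radius ρ/2 keeps b∗b supported in [-ρ, ρ]; the inner radius ρ/4 is where b = 1.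
  set b : ContDiffBump (0 : ℝ) := ⟨ρ / 4, ρ / 2, by linarith, by linarith⟩ with hb
  set a : ℝ × ℝ → ℂ := fun p => (bumpConv b p.1 : ℂ) * (b p.2 : ℂ) with ha
  have ha0 : ∀ p ∉ Metric.closedBall (0 : ℝ × ℝ) ρ, a p = 0 := by
    intro p hp
    rw [mem_closedBall_zero_iff, Prod.norm_def, max_le_iff, not_and_or, not_le, not_le] at hp
    rcases hp with h | h
    · have := bumpConv_eq_zero b (x := p.1) (by
        rw [Real.norm_eq_abs] at h
        change 2 * (ρ / 2) ≤ _
        linarith)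
      simp [ha, this]
    · have := b.zero_of_le_dist (x := p.2) (by
        rw [dist_zero_right]
        change ρ / 2 ≤ _
        linarith)
      simp [ha, this]
  have hac : HasCompactSupport a := HasCompactSupport.intro (isCompact_closedBall 0 ρ) ha0
  have hac1 : ContDiff ℝ 1 a := by
    refine ContDiff.mul (Complex.ofRealCLM.contDiff.comp ((contDiff_bumpConv b).comp contDiff_fst))
      (Complex.ofRealCLM.contDiff.comp (b.contDiff.comp contDiff_snd))
  have hats : tsupport a ⊆ U := by
    refine (closure_minimal (fun p hp => ?_) Metric.isClosed_closedBall).trans hρU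
    by_contra h
    exact hp (ha0 p h)
  set β := ∫ x, b x with hβ
  have hβ0 : 0 < β := b.integral_pos
  -- L makes |λ|^(-1/2) ≤ ρ/4, so b = 1 on the strip used below. The strip has width 2|λ|^(-1/2) and
  -- the integrand there is at least (β/2)², which is the value of c.
  refine ⟨a, ⟨hac1, hac, hats⟩, 2 * (β / 2) ^ 2, 16 / ρ ^ 2, by positivity, by positivity, ?_⟩
  intro lam hlam
  have hlam0 : 0 < |lam| := lt_of_lt_of_le (by positivity) hlam
  set G : ℝ × ℝ → ℂ := fun p =>
    Complex.exp (Complex.I * ((lam * (p.1 * p.2 ^ 2) : ℝ) : ℂ)) * a p with hG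
  have hGi : Integrable G := by
    refine Continuous.integrable_of_hasCompactSupport ?_ hac.mul_left
    have := hac1.continuous
    fun_prop
  have hosc : oscIntegral U lam f a = ∫ p, G p := by
    rw [← setIntegral_eq_integral_of_forall_compl_eq_zero (s := U)]
    · exact setIntegral_congr_fun hU.measurableSet fun p hp => by simp only [hG, hf p hp]
    · intro p hp
      simp only [hG, ha0 p (fun h => hp (hρU h)), mul_zero]
  set c : ℝ → ℝ := fun w => ∫ x : ℝ, Real.cos (w * x) * b x with hc
  have hinner : ∀ y : ℝ, ∫ x : ℝ, G (x, y) = ((c (lam * y ^ 2) ^ 2 * b y : ℝ) : ℂ) := by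
    intro y
    rw [Complex.ofReal_mul, ← integral_exp_mul_bumpConv b (lam * y ^ 2), ← integral_mul_const]
    refine integral_congr_ae (ae_of_all _ fun x => ?_)
    simp only [hG, ha]
    rw [← mul_assoc]
    congr 4
    ring_nf
  have hGi' : Integrable G ((volume : Measure ℝ).prod volume) := hGi
  have hint : Integrable fun y : ℝ => c (lam * y ^ 2) ^ 2 * b y := by
    have h1 := hGi'.integral_prod_right
    simp only [hinner] at h1
    exact h1.re
  have hval : oscIntegral U lam f a = ((∫ y : ℝ, c (lam * y ^ 2) ^ 2 * b y : ℝ) : ℂ) := by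
    rw [hosc, Measure.volume_eq_prod, integral_prod_symm _ hGi', ← integral_complex_ofReal]
    simp only [hinner]
  set s := 1 / √|lam| with hs
  have hs0 : 0 < s := by positivity
  have hssq : |lam| * s ^ 2 = 1 := by
    rw [hs, div_pow, Real.sq_sqrt hlam0.le]
    field_simp
  have hsρ : s ≤ ρ / 4 := by
    have h1 : 4 / ρ ≤ √|lam| := by
      refine Real.le_sqrt_of_sq_le ?_
      rw [div_pow]
      norm_num
      exact hlam
    rw [hs, div_le_iff₀ (Real.sqrt_pos.2 hlam0)]
    calc (1 : ℝ) = ρ / 4 * (4 / ρ) := by field_simp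
      _ ≤ ρ / 4 * √|lam| := by gcongr
  -- On |y| ≤ s the frequency λy² has size at most 1, so the cosine integral is at least β/2;
  -- elsewhere the integrand is nonnegative and can be dropped.
  have hlow : ∫ y : ℝ, (Set.Icc (-s) s).indicator (fun _ => (β / 2) ^ 2) y ≤
      ∫ y : ℝ, c (lam * y ^ 2) ^ 2 * b y := by
    refine integral_mono ?_ hint fun y => ?_
    · exact (integrable_indicator_iff measurableSet_Icc).2 (integrableOn_const (by simp))
    · by_cases hy : y ∈ Set.Icc (-s) s
      · have hys : |y| ≤ s := abs_le.2 hy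
        rw [Set.indicator_of_mem hy]
        have h1 : b y = 1 := b.one_of_mem_closedBall (by
          rw [mem_closedBall_zero_iff]
          exact hys.trans hsρ)
        have h2 : |lam * y ^ 2| ≤ 1 := by
          rw [abs_mul, abs_pow, ← hssq]
          gcongr
        have h3 := half_integral_bump_le b (by change ρ / 2 ≤ 1; linarith) h2
        simp only [h1, mul_one]
        gcongr
      · rw [Set.indicator_of_notMem hy]
        have := b.nonneg (x := y)
        positivity
  rw [integral_indicator measurableSet_Icc, setIntegral_const, smul_eq_mul,
    Real.volume_real_Icc_of_le (by linarith)] at hlow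
  rw [hval, Complex.norm_real, Real.norm_eq_abs, ← Real.sqrt_eq_rpow]
  refine le_trans ?_ (le_abs_self _)
  refine le_trans (le_of_eq ?_) hlow
  rw [hs]
  ring

theorem theorem1
    (V : Set (ℝ × ℝ)) (hVo : IsOpen V) (hVb : Bornology.IsBounded V) (hV0 : (0, 0) ∈ V)
    (f g : ℝ × ℝ → ℝ)
    (hf : IsCkUpToBoundary 8 V f)
    (hg : ContDiffOn ℝ 8 g V)
    (hg0 : ∀ α : ℕ × ℕ, α.1 + α.2 ≤ 3 → mixedPD α g (0, 0) = 0)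
    (hfg : ∀ x ∈ V, f x = x.1 * x.2 ^ 2 + g x) :
    (∃ ε C : ℝ, 0 < ε ∧ 0 < C ∧
      ∃ U : Set (ℝ × ℝ), IsOpen U ∧ (0, 0) ∈ U ∧ U ⊆ V ∧
        ∀ a : ℝ × ℝ → ℂ, IsC1Compact U a →
          ∀ F : ℝ × ℝ → ℝ, IsCkUpToBoundary 8 V F → ckNorm 8 V F < ε →
            ∀ lam : ℝ, lam ≠ 0 →
              ‖oscIntegral U lam (fun x => f x + F x) a‖
                ≤ C * ckNorm 1 U a / |lam| ^ (1 / 2 : ℝ)) ∧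
    ((∀ x ∈ V, g x = 0) →
      ∀ U : Set (ℝ × ℝ), IsOpen U → (0, 0) ∈ U → U ⊆ V →
        ∃ a : ℝ × ℝ → ℂ, IsC1Compact U a ∧
          ∃ c L : ℝ, 0 < c ∧ 0 < L ∧
            ∀ lam : ℝ, L ≤ |lam| →
              c / |lam| ^ (1 / 2 : ℝ) ≤ ‖oscIntegral U lam f a‖) := by
  refine ⟨exists_uniform_bound hVo hVb hV0 hg hg0 hfg, fun hg00 U hU hU0 hUV => ?_⟩
  exact exists_sharp_amplitude hU hU0 fun x hx => by rw [hfg x (hUV hx), hg00 x (hUV hx), add_zero]
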